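/- Let $M$ be a compact complex manifold of complex dimension $n$, let $1\le p\le n-1$ and put $k=n-p$. Write $\mathcal A^{a,b}(M)$ for the space of smooth complex differential forms of type $(a,b)$ on $M$. A form in $\Lambda^{k,0}(T_x^*M\otimes\mathbb C)$ is called simple if it equals $\psi^1\wedge\dots\wedge\psi^k$ for some $(1,0)$-covectors $\psi^1,\dots,\psi^k$ at $x$. Let $\Omega$ be a $p$-pluriclosed structure on $M$, that is, a real form $\Omega\in\mathcal A^{p,p}(M)$ with $\partial\overline\partial\Omega=0$ which is transverse at every point $x\in M$: for every simple $\beta\in\Lambda^{k,0}(T_x^*M\otimes\mathbb C)$, $\beta\ne 0$, the $(n,n)$-form $\sigma_k\,\Omega_x\wedge\beta\wedge\overline\beta$, where $\sigma_k=i^{k^2}2^{-k}$, is strictly positive, i.e. it is a positive real multiple of $\left(\tfrac i2\varphi^1\wedge\overline{\varphi^1}\right)\wedge\dots\wedge\left(\tfrac i2\varphi^n\wedge\overline{\varphi^n}\right)$ for a (equivalently, every) basis $\varphi^1,\dots,\varphi^n$ of the $(1,0)$-covectors at $x$. Suppose that the class of $\Omega$ in the Aeppli cohomology group $$H_A^{p,p}(M)=\frac{\ker\left(\partial\overline\partial:\mathcal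 A^{p,p}(M)\to\mathcal A^{p+1,p+1}(M)\right)}{\partial\mathcal A^{p-1,p}(M)+\overline\partial\mathcal A^{p,p-1}(M)}$$ vanishes. Then there is no form $\xi\in\mathcal A^{k,0}(M)$, not identically zero, that is simple at every point of $M$ and satisfies $\partial\xi=\overline\partial\xi=0$. (In particular there is no nowhere-vanishing such $\xi$ if $M\neq\emptyset$.) -/

import Mathlib

open scoped Manifold ContDiff

noncomputable section

namespace ComplexForms

/-! ### Complex-valued forms on a complex vector space

`V` plays the role of a tangent space `T_x M` with its complex structure `J v = i v`.
A complex `r`-form on `V` is an `ℝ`-multilinear alternating map `V ^ r → ℂ`, that is, an element of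
`Λ^r (V^* ⊗ ℂ)`; a `(1,0)`-form is a `ℂ`-linear map `V → ℂ`. -/

section Pointwise

variable {V : Type*} [AddCommGroup V] [Module ℂ V] [TopologicalSpace V]

/-- Re-indexing of a form along an equality of degrees. -/
def castDegree {r s : ℕ} (h : r = s) (α : V [⋀^Fin r]→L[ℝ] ℂ) : V [⋀^Fin s]→L[ℝ] ℂ :=
  { α.toAlternatingMap.domDomCongr (finCongr h) with
    cont := α.cont.comp (continuous_pi fun _ => continuous_apply _) }

/-- The complex conjugate `v ↦ conj (α v)` of a form. -/
def conjForm {r : ℕ} (α : V [⋀^Fin r]→L[ℝ] ℂ) : V [⋀^Fin r]→L[ℝ] ℂ :=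
  (Complex.conjCLE : ℂ →L[ℝ] ℂ).compContinuousAlternatingMap α

/-- The wedge product as an algebraic alternating map:
`(α ∧ β)(v) = ∑ sign(σ) α(v_{σ 1}, …, v_{σ r}) β(v_{σ (r+1)}, …, v_{σ (r+s)})`, the sum being over
the `(r,s)`-shuffles `σ`. -/
def wedgeAux {r s : ℕ} (α : V [⋀^Fin r]→L[ℝ] ℂ) (β : V [⋀^Fin s]→L[ℝ] ℂ) :
    V [⋀^Fin (r + s)]→ₗ[ℝ] ℂ :=
  ((LinearMap.mul' ℝ ℂ).compAlternatingMap
    (α.toAlternatingMap.domCoprod β.toAlternatingMap)).domDomCongr finSumFinEquiv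

theorem continuous_wedgeAux {r s : ℕ} (α : V [⋀^Fin r]→L[ℝ] ℂ) (β : V [⋀^Fin s]→L[ℝ] ℂ) :
    Continuous (fun v : Fin (r + s) → V => wedgeAux α β v) := by
  have key : ∀ σ : Equiv.Perm.ModSumCongr (Fin r) (Fin s), Continuous fun v : Fin (r + s) → V =>
      LinearMap.mul' ℝ ℂ (AlternatingMap.domCoprod.summand α.toAlternatingMap β.toAlternatingMap σ
        (fun i => v (finSumFinEquiv i))) := by
    intro σ
    induction σ using Quotient.inductionOn' with | _ σ
    have h : ∀ v : Fin (r + s) → V,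
        LinearMap.mul' ℝ ℂ (AlternatingMap.domCoprod.summand α.toAlternatingMap β.toAlternatingMap
          (Quotient.mk'' σ) (fun i => v (finSumFinEquiv i))) =
        Equiv.Perm.sign σ • (α (fun i => v (finSumFinEquiv (σ (Sum.inl i)))) *
          β (fun i => v (finSumFinEquiv (σ (Sum.inr i))))) := by
      intro v
      rw [AlternatingMap.domCoprod.summand_mk'']
      rcases Int.units_eq_one_or (Equiv.Perm.sign σ) with h | h <;> rw [h] <;>
        simp [MultilinearMap.domCoprod_apply]
    simp only [h]
    refine Continuous.const_smul (Continuous.mul ?_ ?_) _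
    · exact α.cont.comp (continuous_pi fun i => continuous_apply _)
    · exact β.cont.comp (continuous_pi fun i => continuous_apply _)
  have h : (fun v : Fin (r + s) → V => wedgeAux α β v) = fun v =>
      ∑ σ : Equiv.Perm.ModSumCongr (Fin r) (Fin s), LinearMap.mul' ℝ ℂ
        (AlternatingMap.domCoprod.summand α.toAlternatingMap β.toAlternatingMap σ
          (fun i => v (finSumFinEquiv i))) := by
    funext v
    simp [wedgeAux, AlternatingMap.domCoprod_apply, Function.comp_def]
  rw [h]
  exact continuous_finsetSum _ fun σ _ => key σ

/-- The wedge product `α ∧ β`. -/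
def wedge {r s : ℕ} (α : V [⋀^Fin r]→L[ℝ] ℂ) (β : V [⋀^Fin s]→L[ℝ] ℂ) :
    V [⋀^Fin (r + s)]→L[ℝ] ℂ :=
  { wedgeAux α β with cont := continuous_wedgeAux α β }

/-- The form `ψ^1 ∧ ⋯ ∧ ψ^r`, that is `(v_1, …, v_r) ↦ det (ψ^j (v_i))`, for `(1,0)`-forms
`ψ^1, …, ψ^r`. -/
def wedgeCovectors {r : ℕ} (ψ : Fin r → V →L[ℂ] ℂ) : V [⋀^Fin r]→L[ℝ] ℂ where
  toFun v := Matrix.det (Matrix.of fun i j => ψ j (v i))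
  map_update_add' v i x y := by
    rename_i inst
    obtain rfl : inst = instDecidableEqFin r := Subsingleton.elim _ _
    have h : ∀ z, (Matrix.of fun a j => ψ j (Function.update v i z a)) =
        Matrix.updateRow (Matrix.of fun a j => ψ j (v a)) i (fun j => ψ j z) := by
      intro z
      ext a j
      by_cases hai : a = i
      · subst hai; simp
      · simp [hai]
    simp only [h, map_add]
    exact Matrix.det_updateRow_add _ _ _ _
  map_update_smul' v i c x := by
    rename_i inst
    obtain rfl : inst = instDecidableEqFin r := Subsingleton.elim _ _
    have h : ∀ z, (Matrix.of fun a j => ψ j (Function.update v i z a)) =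
        Matrix.updateRow (Matrix.of fun a j => ψ j (v a)) i (fun j => ψ j z) := by
      intro z
      ext a j
      by_cases hai : a = i
      · subst hai; simp
      · simp [hai]
    have hc : (fun j => ψ j (c • x)) = (c : ℂ) • fun j => ψ j x := by
      funext j
      rw [← Complex.coe_smul c x, map_smul]
      rfl
    rw [h, h, hc, Matrix.det_updateRow_smul]
    exact Complex.real_smul.symm
  map_eq_zero_of_eq' v i j h hij := by
    refine Matrix.det_zero_of_row_eq hij ?_
    funext l
    simp [h]
  cont := by
    refine Continuous.matrix_det (continuous_matrix fun i j => ?_)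
    exact (ψ j).continuous.comp (continuous_apply i)

/-- A form `ψ ∈ Λ^{r,0}` is simple if `ψ = ψ^1 ∧ ⋯ ∧ ψ^r` with `ψ^i ∈ Λ^{1,0}`. -/
def IsSimple {r : ℕ} (α : V [⋀^Fin r]→L[ℝ] ℂ) : Prop :=
  ∃ ψ : Fin r → V →L[ℂ] ℂ, α = wedgeCovectors ψ

/-- The space `Λ^{p,q}` of forms of type `(p,q)`: the `ℂ`-linear span of the forms
`φ^1 ∧ ⋯ ∧ φ^p ∧ conj ψ^1 ∧ ⋯ ∧ conj ψ^q` with `φ^i, ψ^j ∈ Λ^{1,0}`. It is considered inside the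
forms of degree `r`, and only `r = p + q` is of interest. -/
def typeForms (V : Type*) [AddCommGroup V] [Module ℂ V] [TopologicalSpace V] (p q r : ℕ) :
    Submodule ℂ (V [⋀^Fin r]→L[ℝ] ℂ) :=
  Submodule.span ℂ {α | ∃ (h : p + q = r) (φ : Fin p → V →L[ℂ] ℂ) (ψ : Fin q → V →L[ℂ] ℂ),
    α = castDegree h (wedge (wedgeCovectors φ) (conjForm (wedgeCovectors ψ)))}

/-- The constant `σ_m = i^{m²} 2^{-m}`. -/
def sigmaConst (m : ℕ) : ℂ := Complex.I ^ (m ^ 2) / 2 ^ m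

/-- The volume form `∏ (i/2 φ^j ∧ conj φ^j) = σ_n φ^1 ∧ ⋯ ∧ φ^n ∧ conj φ^1 ∧ ⋯ ∧ conj φ^n` of a
basis `φ` of `Λ^{1,0}`. -/
def volForm {n : ℕ} (φ : Module.Basis (Fin n) ℂ (V →L[ℂ] ℂ)) : V [⋀^Fin (n + n)]→L[ℝ] ℂ :=
  sigmaConst n • wedge (wedgeCovectors φ) (conjForm (wedgeCovectors φ))

/-- A form `τ` of top degree `r = 2n`, `n = dim_ℂ V`, is strictly positive if `τ = a Vol` with
`a > 0` (this does not depend on the basis of `Λ^{1,0}` that defines `Vol`). -/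
def IsStrictlyPositive {r : ℕ} (τ : V [⋀^Fin r]→L[ℝ] ℂ) : Prop :=
  ∃ h : r = Module.finrank ℂ V + Module.finrank ℂ V,
    ∀ φ : Module.Basis (Fin (Module.finrank ℂ V)) ℂ (V →L[ℂ] ℂ),
      ∃ a : ℝ, 0 < a ∧ castDegree h τ = (a : ℂ) • volForm φ

/-- A form `Ω` (real, of type `(p,p)`) is transverse if `σ_{n-p} Ω ∧ β ∧ conj β` is strictly
positive for every simple `β ∈ Λ^{n-p,0}`, `β ≠ 0`, where `n = dim_ℂ V`. -/
def IsTransverse (p : ℕ) (Ω : V [⋀^Fin (p + p)]→L[ℝ] ℂ) : Prop :=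
  ∀ β : V [⋀^Fin (Module.finrank ℂ V - p)]→L[ℝ] ℂ, IsSimple β → β ≠ 0 →
    IsStrictlyPositive (sigmaConst (Module.finrank ℂ V - p) • wedge (wedge Ω β) (conjForm β))

end Pointwise

/-! ### Differential forms on a complex manifold

`M` is a complex manifold modelled on the complex vector space `E`. -/

section Manifold

variable {E : Type*} [NormedAddCommGroup E] [NormedSpace ℂ E]

/-- The `ℂ`-linear part `v ↦ (T v - i T (i v)) / 2` of an `ℝ`-linear map with values in forms. -/
def linearPart {r : ℕ} (T : E →L[ℝ] E [⋀^Fin r]→L[ℝ] ℂ) : E →L[ℝ] E [⋀^Fin r]→L[ℝ] ℂ :=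
  (1 / 2 : ℂ) • (T - Complex.I • T.comp
    ((Complex.I • ContinuousLinearMap.id ℂ E).restrictScalars ℝ))

/-- The `ℂ`-antilinear part `v ↦ (T v + i T (i v)) / 2` of an `ℝ`-linear map with values in
forms. -/
def antilinearPart {r : ℕ} (T : E →L[ℝ] E [⋀^Fin r]→L[ℝ] ℂ) : E →L[ℝ] E [⋀^Fin r]→L[ℝ] ℂ :=
  (1 / 2 : ℂ) • (T + Complex.I • T.comp
    ((Complex.I • ContinuousLinearMap.id ℂ E).restrictScalars ℝ))

/-- The operator `∂` in the coordinates of `E`: `∂ (f dz_I ∧ d\bar z_J) = ∂f ∧ dz_I ∧ d\bar z_J`,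
`∂f` being the `ℂ`-linear part of `df`. In terms of the exterior derivative
`dη(v_0, …, v_r) = ∑ (-1)^i (D_{v_i} η)(v_0, …, \hat{v_i}, …, v_r)`, the directional derivative
`D_v` is replaced by `(D_v - i D_{iv}) / 2`. -/
def delCoord {r : ℕ} (η : E → E [⋀^Fin r]→L[ℝ] ℂ) (y : E) : E [⋀^Fin (r + 1)]→L[ℝ] ℂ :=
  ContinuousAlternatingMap.alternatizeUncurryFin (linearPart (fderiv ℝ η y))

/-- The operator `∂bar` in the coordinates of `E`. -/
def delbarCoord {r : ℕ} (η : E → E [⋀^Fin r]→L[ℝ] ℂ) (y : E) : E [⋀^Fin (r + 1)]→L[ℝ] ℂ :=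
  ContinuousAlternatingMap.alternatizeUncurryFin (antilinearPart (fderiv ℝ η y))

theorem delCoord_add_delbarCoord {r : ℕ} (η : E → E [⋀^Fin r]→L[ℝ] ℂ) (y : E) :
    delCoord η y + delbarCoord η y = extDeriv η y := by
  rw [delCoord, delbarCoord, ← ContinuousAlternatingMap.alternatizeUncurryFin_add, extDeriv]
  congr 1
  ext v w
  simp [linearPart, antilinearPart]
  ring

/-- A complex differential `r`-form on `M`, not necessarily continuous. -/
abbrev DiffForm (E : Type*) [NormedAddCommGroup E] [NormedSpace ℂ E] (M : Type*)
    [TopologicalSpace M] [ChartedSpace E M] (r : ℕ) : Type _ :=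
  (x : M) → (TangentSpace 𝓘(ℂ, E) x) [⋀^Fin r]→L[ℝ] ℂ

variable {M : Type*} [TopologicalSpace M] [ChartedSpace E M]

/-- The expression of a form in the holomorphic chart at `x₀`: its pullback under the inverse of
the chart, which is a form on (the target of the chart in) `E`. -/
def inChart {r : ℕ} (η : DiffForm E M r) (x₀ : M) (y : E) : E [⋀^Fin r]→L[ℝ] ℂ :=
  (η ((extChartAt 𝓘(ℂ, E) x₀).symm y)).compContinuousLinearMap
    ((mfderiv 𝓘(ℂ, E) 𝓘(ℂ, E) (extChartAt 𝓘(ℂ, E) x₀).symm y).restrictScalars ℝ)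

/-- The form is smooth (over `ℝ`): all its expressions in charts are. -/
def IsSmooth {r : ℕ} (η : DiffForm E M r) : Prop :=
  ∀ x₀ : M, ContDiffOn ℝ ∞ (inChart η x₀) (extChartAt 𝓘(ℂ, E) x₀).target

/-- The operator `∂` on complex differential forms. -/
def del {r : ℕ} (η : DiffForm E M r) : DiffForm E M (r + 1) := fun x =>
  (delCoord (inChart η x) (extChartAt 𝓘(ℂ, E) x x)).compContinuousLinearMap
    ((mfderiv 𝓘(ℂ, E) 𝓘(ℂ, E) (extChartAt 𝓘(ℂ, E) x) x).restrictScalars ℝ)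

/-- The operator `∂bar` on complex differential forms. -/
def delbar {r : ℕ} (η : DiffForm E M r) : DiffForm E M (r + 1) := fun x =>
  (delbarCoord (inChart η x) (extChartAt 𝓘(ℂ, E) x x)).compContinuousLinearMap
    ((mfderiv 𝓘(ℂ, E) 𝓘(ℂ, E) (extChartAt 𝓘(ℂ, E) x) x).restrictScalars ℝ)

/-- The form belongs to `𝒜^{p,q}(M)`: it is smooth and of type `(p,q)` at every point. -/
def IsSmoothOfType (p q : ℕ) {r : ℕ} (η : DiffForm E M r) : Prop :=
  IsSmooth η ∧ ∀ x, η x ∈ typeForms (TangentSpace 𝓘(ℂ, E) x) p q r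

/-- `Ω` is a `p`-pluriclosed structure: a real smooth `(p,p)`-form that is transverse at every point
and satisfies `∂ ∂bar Ω = 0`. -/
structure IsPluriclosed (p : ℕ) (Ω : DiffForm E M (p + p)) : Prop where
  smoothOfType : IsSmoothOfType p p Ω
  real : ∀ x, conjForm (Ω x) = Ω x
  transverse : ∀ x, IsTransverse p (Ω x)
  del_delbar : del (delbar Ω) = 0

/-- For `p ≥ 1`, the class of the `(p,p)`-form `Ω` in
`H_A^{p,p}(M) = Ker (∂ ∂bar) / (Im ∂ + Im ∂bar)` vanishes: `Ω = ∂ μ + ∂bar ν` for some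
`μ ∈ 𝒜^{p-1,p}(M)` and `ν ∈ 𝒜^{p,p-1}(M)`. -/
def AeppliClassVanishes (p : ℕ) (Ω : DiffForm E M (p + p)) : Prop :=
  ∃ (s : ℕ) (h : s + 1 = p + p) (μ ν : DiffForm E M s),
    IsSmoothOfType (p - 1) p μ ∧ IsSmoothOfType p (p - 1) ν ∧
      ∀ x, Ω x = castDegree h (del μ x + delbar ν x)

end Manifold

end ComplexForms

end

/-!
Suppose that `Ω = ∂μ + ∂bar ν` with `μ` of type `(p-1,p)` and `ν` of type `(p,p-1)`, and that `ξ` is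
a closed form of type `(k,0)`, simple at every point, where `k = n - p`. The forms `∂bar μ` and `∂ν`
have types `(p-1,p+1)` and `(p+1,p-1)`, so their products with `ξ ∧ conj ξ` would have types
`(n-1,n+1)` and `(n+1,n-1)` and therefore vanish. As `ξ` and `conj ξ` are closed, the Leibniz rule
gives `d((μ + ν) ∧ ξ ∧ conj ξ) = Ω ∧ ξ ∧ conj ξ` (`extDeriv_inChart_wedge_eq`). Up to the constant
`σ_k` the right side is a nonnegative top degree form, positive wherever `ξ ≠ 0`, because `Ω` is
transverse. By Stokes' theorem its integral over the compact manifold `M` is zero, so it vanishes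
identically (`extDeriv_inChart_eq_zero_of_nonneg`), and `ξ = 0`.

The vanishing for reasons of type is obtained without the decomposition into types: a `(p,q)`-form
is an eigenvector of the pullback by multiplication by `i`, with eigenvalue `i^p (-i)^q`, whereas
this pullback is the identity on forms of degree `2n`, since multiplication by `i` has real
determinant `1` (`HasJWeight.eq_zero`).

Identities between wedge products are reduced to manipulations of signed sums over all
permutations (`altSum`), where iterated antisymmetrization only produces a factorial
(`altSum_altSum`).

Stokes' theorem is proved with a finite smooth partition of unity `ρ` subordinate to charts. The
integral of a top degree form `τ` is the sum over `j` of the integrals of `ρ j • τ` in the chart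
`j`. For `τ = d(ρ i • η)` each summand may be moved to the chart `i`, because transition maps are
holomorphic and so have nonnegative real Jacobian determinant, and there the sum is the integral of
the derivative of a compactly supported form.
-/

noncomputable section

namespace ComplexForms

/-! ### Signed sums over permutations -/

section AltSum

variable {V ι κ : Type*} [Fintype ι] [DecidableEq ι] [Fintype κ] [DecidableEq κ]

/-- The signed sum `v ↦ ∑ sign(σ) f(v ∘ σ)` over all permutations `σ` of the arguments, for an
arbitrary function `f` of a family of vectors. -/
def altSum (f : (ι → V) → ℂ) (v : ι → V) : ℂ :=
  ∑ σ : Equiv.Perm ι, ((Equiv.Perm.sign σ : ℤ) : ℂ) * f (v ∘ σ)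

theorem sign_mul_self (σ : Equiv.Perm ι) :
    ((Equiv.Perm.sign σ : ℤ) : ℂ) * ((Equiv.Perm.sign σ : ℤ) : ℂ) = 1 := by
  rcases Int.units_eq_one_or (Equiv.Perm.sign σ) with h | h <;> simp [h]

theorem altSum_const_mul (c : ℂ) (f : (ι → V) → ℂ) (v : ι → V) :
    altSum (fun w => c * f w) v = c * altSum f v := by
  simp only [altSum, Finset.mul_sum]
  exact Finset.sum_congr rfl fun _ _ => by ring

theorem altSum_comp_perm (τ : Equiv.Perm ι) (f : (ι → V) → ℂ) (v : ι → V) :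
    altSum (fun w => f (w ∘ τ)) v = ((Equiv.Perm.sign τ : ℤ) : ℂ) * altSum f v := by
  rw [altSum, altSum, Finset.mul_sum]
  refine Fintype.sum_equiv (Equiv.mulRight τ) _ _ fun σ => ?_
  simp only [Equiv.coe_mulRight, Equiv.Perm.sign_mul, Units.val_mul, Int.cast_mul]
  rw [mul_comm (((Equiv.Perm.sign σ : ℤ) : ℂ)) (((Equiv.Perm.sign τ : ℤ) : ℂ)), ← mul_assoc,
    ← mul_assoc, sign_mul_self, one_mul]
  rfl

theorem altSum_comp_equiv (e : ι ≃ κ) (f : (ι → V) → ℂ) (v : κ → V) :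
    altSum (fun w : κ → V => f (w ∘ e)) v = altSum f (v ∘ e) := by
  rw [altSum, altSum]
  refine (Fintype.sum_equiv e.permCongr _ _ fun σ => ?_).symm
  rw [Equiv.Perm.sign_permCongr]
  congr 2
  funext i
  simp

/-- Antisymmetrizing first in the arguments indexed by `κ` and then in all arguments multiplies the
signed sum by `|κ|!`. -/
theorem altSum_sum_viaFintypeEmbedding (j : κ ↪ ι) (f : (ι → V) → ℂ) (v : ι → V) :
    altSum (fun w => ∑ τ : Equiv.Perm κ,
      ((Equiv.Perm.sign τ : ℤ) : ℂ) * f (w ∘ τ.viaFintypeEmbedding j)) v =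
    ((Fintype.card κ).factorial : ℂ) * altSum f v := by
  have h : ∀ τ : Equiv.Perm κ, ∑ σ : Equiv.Perm ι, ((Equiv.Perm.sign σ : ℤ) : ℂ) *
      (((Equiv.Perm.sign τ : ℤ) : ℂ) * f ((v ∘ σ) ∘ τ.viaFintypeEmbedding j)) = altSum f v := by
    intro τ
    have := altSum_comp_perm (τ.viaFintypeEmbedding j) f v
    rw [Equiv.Perm.viaFintypeEmbedding_sign] at this
    calc _ = ((Equiv.Perm.sign τ : ℤ) : ℂ) *
          altSum (fun w => f (w ∘ τ.viaFintypeEmbedding j)) v := by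
          rw [altSum, Finset.mul_sum]
          exact Finset.sum_congr rfl fun _ _ => by ring
      _ = _ := by rw [this, ← mul_assoc, sign_mul_self, one_mul]
  simp only [altSum, Finset.mul_sum]
  rw [Finset.sum_comm]
  rw [Finset.sum_congr rfl fun τ _ => h τ]
  simp [altSum, Fintype.card_perm, Finset.mul_sum]

/-- Version of `altSum_sum_viaFintypeEmbedding` in which the inner signed sum is only concerned with
the arguments indexed by `κ`, the remaining ones being frozen in `g`. -/
theorem altSum_altSum (j : κ ↪ ι) (g : (ι → V) → (κ → V) → ℂ)
    (hg : ∀ w w' : ι → V, (∀ i ∉ Set.range j, w i = w' i) → g w = g w') (v : ι → V) :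
    altSum (fun w => altSum (g w) (w ∘ j)) v =
      ((Fintype.card κ).factorial : ℂ) * altSum (fun w => g w (w ∘ j)) v := by
  rw [← altSum_sum_viaFintypeEmbedding j]
  congr 1
  funext w
  rw [altSum]
  refine Finset.sum_congr rfl fun τ _ => ?_
  congr 1
  rw [hg (w ∘ τ.viaFintypeEmbedding j) w]
  · congr 1
    funext i
    simp [Equiv.Perm.viaFintypeEmbedding_apply_image]
  · intro i hi
    simp [Equiv.Perm.viaFintypeEmbedding_apply_notMem_range _ _ hi]

theorem altSum_prod_eq_det (φ : ι → V → ℂ) (v : ι → V) :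
    altSum (fun w => ∏ i, φ i (w i)) v = Matrix.det (Matrix.of fun i j => φ j (v i)) := by
  rw [Matrix.det_apply, altSum]
  refine Finset.sum_congr rfl fun σ _ => ?_
  rcases Int.units_eq_one_or (Equiv.Perm.sign σ) with h | h <;> rw [h] <;> simp

end AltSum

/-! ### Wedge products as signed sums -/

section Algebra

variable {V : Type*} [AddCommGroup V] [Module ℂ V] [TopologicalSpace V]

theorem altSum_form {r : ℕ} (α : V [⋀^Fin r]→L[ℝ] ℂ) (v : Fin r → V) :
    altSum α v = (r.factorial : ℂ) * α v := by
  have h : ∀ σ : Equiv.Perm (Fin r),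
      ((Equiv.Perm.sign σ : ℤ) : ℂ) * α (v ∘ σ) = α v := by
    intro σ
    have := α.toAlternatingMap.map_perm v σ
    have h2 : α (v ∘ σ) = Equiv.Perm.sign σ • α v := this
    rw [h2]
    rcases Int.units_eq_one_or (Equiv.Perm.sign σ) with h | h <;> simp [h]
  simp only [altSum, h]
  simp [Fintype.card_perm]

/-- The wedge product as a signed sum over all permutations rather than over shuffles. -/
theorem wedge_apply {r s : ℕ} (α : V [⋀^Fin r]→L[ℝ] ℂ) (β : V [⋀^Fin s]→L[ℝ] ℂ)
    (v : Fin (r + s) → V) :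
    ((r.factorial * s.factorial : ℕ) : ℂ) * wedge α β v =
      altSum (fun w => α (w ∘ Fin.castAdd s) * β (w ∘ Fin.natAdd r)) v := by
  have h := MultilinearMap.domCoprod_alternization_eq α.toAlternatingMap β.toAlternatingMap
  have h1 := congrArg (fun A => LinearMap.mul' ℝ ℂ (A (v ∘ finSumFinEquiv))) h
  simp only [Fintype.card_fin] at h1
  have e : (fun w : Fin (r + s) → V => α (w ∘ Fin.castAdd s) * β (w ∘ Fin.natAdd r)) =
      fun w => (fun u : Fin r ⊕ Fin s → V => α (u ∘ Sum.inl) * β (u ∘ Sum.inr))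
        (w ∘ finSumFinEquiv) := by
    funext w
    rfl
  rw [e, altSum_comp_equiv finSumFinEquiv
    (fun u : Fin r ⊕ Fin s → V => α (u ∘ Sum.inl) * β (u ∘ Sum.inr))]
  calc _ = LinearMap.mul' ℝ ℂ (((r.factorial * s.factorial) •
        α.toAlternatingMap.domCoprod β.toAlternatingMap) (v ∘ finSumFinEquiv)) := by
        rw [AlternatingMap.smul_apply, map_nsmul, nsmul_eq_mul]
        rfl
    _ = _ := by
      rw [← h1, MultilinearMap.alternatization_apply, map_sum, altSum]
      refine Finset.sum_congr rfl fun σ _ => ?_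
      rcases Int.units_eq_one_or (Equiv.Perm.sign σ) with h | h <;> rw [h] <;>
        simp [MultilinearMap.domCoprod_apply] <;> rfl

theorem wedgeCovectors_apply {r : ℕ} (φ : Fin r → V →L[ℂ] ℂ) (v : Fin r → V) :
    wedgeCovectors φ v = altSum (fun w => ∏ i, φ i (w i)) v :=
  (altSum_prod_eq_det (fun i w => φ i w) v).symm

end Algebra

/-! ### The Leibniz rule -/

section Alternatize

variable {E : Type*} [NormedAddCommGroup E] [NormedSpace ℂ E]

/-- `alternatizeUncurryFin T` as a signed sum over all permutations: the sum over the position of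
the first argument is extended to all permutations by the antisymmetry of `T v`. -/
theorem factorial_mul_alternatizeUncurryFin {r : ℕ} (T : E →L[ℝ] E [⋀^Fin r]→L[ℝ] ℂ)
    (v : Fin (r + 1) → E) :
    (r.factorial : ℂ) * ContinuousAlternatingMap.alternatizeUncurryFin T v =
      altSum (fun w => T (w 0) (Fin.tail w)) v := by
  have hr : ((r + 1 : ℕ) : ℂ) ≠ 0 := by exact_mod_cast Nat.succ_ne_zero r
  have h1 := altSum_form (ContinuousAlternatingMap.alternatizeUncurryFin T) v
  have h2 : ∀ w : Fin (r + 1) → E, ContinuousAlternatingMap.alternatizeUncurryFin T w =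
      ∑ i : Fin (r + 1), ((Equiv.Perm.sign (i.cycleRange.symm) : ℤ) : ℂ) *
        (fun u : Fin (r + 1) → E => T (u 0) (Fin.tail u)) (w ∘ i.cycleRange.symm) := by
    intro w
    rw [ContinuousAlternatingMap.alternatizeUncurryFin_apply]
    refine Finset.sum_congr rfl fun i _ => ?_
    have hw : w ∘ i.cycleRange.symm = Fin.cons (w i) (i.removeNth w) := by
      conv_lhs => rw [← Fin.insertNth_self_removeNth i w]
      rw [Fin.insertNth_comp_cycleRange_symm]
    simp only [hw, Equiv.Perm.sign_symm, Fin.sign_cycleRange, Fin.cons_zero, Fin.tail_cons]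
    simp
  have h3 : altSum (ContinuousAlternatingMap.alternatizeUncurryFin T) v =
      ((r + 1 : ℕ) : ℂ) * altSum (fun w => T (w 0) (Fin.tail w)) v := by
    have : altSum (ContinuousAlternatingMap.alternatizeUncurryFin T) v =
        ∑ i : Fin (r + 1), ((Equiv.Perm.sign (i.cycleRange.symm) : ℤ) : ℂ) *
          altSum (fun w => (fun u : Fin (r + 1) → E => T (u 0) (Fin.tail u))
            (w ∘ i.cycleRange.symm)) v := by
      simp only [altSum, h2, Finset.mul_sum]
      rw [Finset.sum_comm]
      exact Finset.sum_congr rfl fun _ _ => Finset.sum_congr rfl fun _ _ => by ring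
    rw [this]
    have hi : ∀ i : Fin (r + 1), ((Equiv.Perm.sign (i.cycleRange.symm) : ℤ) : ℂ) *
          altSum (fun w => (fun u : Fin (r + 1) → E => T (u 0) (Fin.tail u))
            (w ∘ i.cycleRange.symm)) v = altSum (fun w => T (w 0) (Fin.tail w)) v := by
      intro i
      rw [altSum_comp_perm i.cycleRange.symm (fun u : Fin (r + 1) → E => T (u 0) (Fin.tail u)),
        ← mul_assoc, sign_mul_self, one_mul]
    rw [Finset.sum_congr rfl fun i _ => hi i]
    simp
  rw [h3, Nat.factorial_succ] at h1
  push_cast at h1 hr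
  rw [mul_assoc] at h1
  exact (mul_left_cancel₀ hr h1).symm

theorem factorial_mul_alternatizeUncurryFin_wedge {r s : ℕ} (A : E → E [⋀^Fin r]→L[ℝ] ℂ)
    (B : E → E [⋀^Fin s]→L[ℝ] ℂ) (T : E →L[ℝ] E [⋀^Fin (r + s)]→L[ℝ] ℂ)
    (hT : ∀ v, T v = wedge (A v) (B v)) (v : Fin (r + s + 1) → E) :
    ((r.factorial * s.factorial : ℕ) : ℂ) * ContinuousAlternatingMap.alternatizeUncurryFin T v =
      altSum (fun w => A (w 0) (Fin.tail w ∘ Fin.castAdd s) *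
        B (w 0) (Fin.tail w ∘ Fin.natAdd r)) v := by
  have a1 := factorial_mul_alternatizeUncurryFin T v
  have a2 : ∀ w : Fin (r + s + 1) → E, ((r.factorial * s.factorial : ℕ) : ℂ) *
      T (w 0) (Fin.tail w) = altSum (fun u : Fin (r + s) → E =>
        A (w 0) (u ∘ Fin.castAdd s) * B (w 0) (u ∘ Fin.natAdd r))
          (w ∘ Fin.succEmb (r + s)) := by
    intro w
    rw [hT, wedge_apply]
    rfl
  apply mul_left_cancel₀ (show ((r + s).factorial : ℂ) ≠ 0 by
    exact_mod_cast (r + s).factorial_ne_zero)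
  rw [mul_left_comm, a1, ← altSum_const_mul]
  simp only [a2]
  rw [altSum_altSum (Fin.succEmb (r + s)) (fun w u =>
        A (w 0) (u ∘ Fin.castAdd s) * B (w 0) (u ∘ Fin.natAdd r))]
  · simp only [Fintype.card_fin]
    rfl
  · intro w w' hw
    have : w 0 = w' 0 := hw 0 (by simp)
    simp [this]

/-- The Leibniz rule on the first factor, for the alternatization that defines `d`, `∂`, `∂bar`. -/
theorem alternatizeUncurryFin_wedge_left {r s : ℕ} (T : E →L[ℝ] E [⋀^Fin r]→L[ℝ] ℂ)
    (β : E [⋀^Fin s]→L[ℝ] ℂ) (T' : E →L[ℝ] E [⋀^Fin (r + s)]→L[ℝ] ℂ)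
    (hT' : ∀ v, T' v = wedge (T v) β) (h : r + 1 + s = r + s + 1) :
    ContinuousAlternatingMap.alternatizeUncurryFin T' =
      castDegree h (wedge (ContinuousAlternatingMap.alternatizeUncurryFin T) β) := by
  ext v
  have hc : ∀ n : ℕ, (n.factorial : ℂ) ≠ 0 := fun n => by exact_mod_cast n.factorial_ne_zero
  -- both sides are multiples of the signed sum of `f`
  set f : (Fin (r + s + 1) → E) → ℂ := fun w => T (w 0) (Fin.tail w ∘ Fin.castAdd s) *
    β (Fin.tail w ∘ Fin.natAdd r) with hf
  have h1 : ((r.factorial * s.factorial : ℕ) : ℂ) *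
      ContinuousAlternatingMap.alternatizeUncurryFin T' v = altSum f v :=
    factorial_mul_alternatizeUncurryFin_wedge (fun v => T v) (fun _ => β) T' hT' v
  have h2 : ((r.factorial * s.factorial : ℕ) : ℂ) * castDegree h
      (wedge (ContinuousAlternatingMap.alternatizeUncurryFin T) β) v = altSum f v := by
    have b1 := wedge_apply (ContinuousAlternatingMap.alternatizeUncurryFin T) β
      (v ∘ finCongr h)
    have b2 : ∀ w : Fin (r + 1 + s) → E, (r.factorial : ℂ) *
        (ContinuousAlternatingMap.alternatizeUncurryFin T (w ∘ Fin.castAdd s) *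
          β (w ∘ Fin.natAdd (r + 1))) = altSum (fun u : Fin (r + 1) → E => T (u 0) (Fin.tail u) *
            β (w ∘ Fin.natAdd (r + 1))) (w ∘ (Fin.castAddEmb s : Fin (r + 1) ↪ _)) := by
      intro w
      rw [← mul_assoc, factorial_mul_alternatizeUncurryFin, altSum, altSum, Finset.sum_mul]
      exact Finset.sum_congr rfl fun _ _ => by simp [mul_assoc, Function.comp_def]
    have b3 : altSum f v = altSum (fun w : Fin (r + 1 + s) → E =>
        T ((w ∘ Fin.castAdd s) 0) (Fin.tail (w ∘ Fin.castAdd s)) * β (w ∘ Fin.natAdd (r + 1)))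
          (v ∘ finCongr h) := by
      rw [← altSum_comp_equiv (finCongr h)]
      congr 1
      funext w
      refine congrArg₂ (· * ·) ?_ ?_
      · rfl
      · refine congrArg β ?_
        funext i
        simp only [Fin.tail, Function.comp_apply]
        congr 1
        ext
        simp
        omega
    apply mul_left_cancel₀ (hc (r + 1))
    rw [b3]
    have b4 := altSum_altSum (Fin.castAddEmb s : Fin (r + 1) ↪ Fin (r + 1 + s))
      (fun w u => T (u 0) (Fin.tail u) * β (w ∘ Fin.natAdd (r + 1))) (by
        intro w w' hw
        have : w ∘ Fin.natAdd (r + 1) = w' ∘ Fin.natAdd (r + 1) := by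
          funext i
          refine hw _ ?_
          rintro ⟨k, hk⟩
          have := congrArg Fin.val hk
          simp at this
          omega
        simp [this]) (v ∘ finCongr h)
    simp only [Fintype.card_fin] at b4
    have b5 : castDegree h (wedge (ContinuousAlternatingMap.alternatizeUncurryFin T) β) v =
      wedge (ContinuousAlternatingMap.alternatizeUncurryFin T) β (v ∘ finCongr h) := rfl
    rw [b5]
    refine Eq.trans ?_ b4
    simp only [← b2]
    rw [altSum_const_mul, ← b1]
    push_cast
    ring
  refine mul_left_cancel₀ ?_ (h1.trans h2.symm)
  exact_mod_cast mul_ne_zero r.factorial_ne_zero s.factorial_ne_zero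

/-- The Leibniz rule on the second factor, when that factor is closed. -/
theorem alternatizeUncurryFin_wedge_right {r s : ℕ} (S : E →L[ℝ] E [⋀^Fin s]→L[ℝ] ℂ)
    (α : E [⋀^Fin r]→L[ℝ] ℂ) (S' : E →L[ℝ] E [⋀^Fin (r + s)]→L[ℝ] ℂ)
    (hS' : ∀ v, S' v = wedge α (S v))
    (hS : ContinuousAlternatingMap.alternatizeUncurryFin S = 0) :
    ContinuousAlternatingMap.alternatizeUncurryFin S' = 0 := by
  ext v
  have hc : ∀ n : ℕ, (n.factorial : ℂ) ≠ 0 := fun n => by exact_mod_cast n.factorial_ne_zero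
  set f : (Fin (r + s + 1) → E) → ℂ := fun w => α (Fin.tail w ∘ Fin.castAdd s) *
    S (w 0) (Fin.tail w ∘ Fin.natAdd r) with hf
  have h1 : ((r.factorial * s.factorial : ℕ) : ℂ) *
      ContinuousAlternatingMap.alternatizeUncurryFin S' v = altSum f v :=
    factorial_mul_alternatizeUncurryFin_wedge (fun _ => α) (fun v => S v) S' hS' v
  -- the arguments of `S` together with the direction of differentiation
  let j : Fin (s + 1) ↪ Fin (r + s + 1) :=
    ⟨Fin.cons 0 (fun i => (Fin.natAdd r i).succ), by
      rw [Fin.cons_injective_iff]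
      refine ⟨?_, ?_⟩
      · rintro ⟨i, hi⟩
        exact Fin.succ_ne_zero _ hi
      · intro a b hab
        exact Fin.natAdd_injective _ _ (Fin.succ_injective _ hab)⟩
  have h2 : ((s + 1).factorial : ℂ) * altSum f v = 0 := by
    have b4 := altSum_altSum j
      (fun w u => α (Fin.tail w ∘ Fin.castAdd s) * S (u 0) (Fin.tail u)) (by
        intro w w' hw
        have : Fin.tail w ∘ Fin.castAdd s = Fin.tail w' ∘ Fin.castAdd s := by
          funext i
          refine hw _ ?_
          rintro ⟨k, hk⟩
          have hk' := congrArg Fin.val hk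
          induction k using Fin.cases with
          | zero => simp [j] at hk'
          | succ k => simp [j] at hk'; omega
        simp [this]) v
    simp only [Fintype.card_fin] at b4
    have b5 : altSum f v = altSum (fun w : Fin (r + s + 1) → E =>
        α (Fin.tail w ∘ Fin.castAdd s) * S ((w ∘ j) 0) (Fin.tail (w ∘ j))) v := rfl
    rw [b5, ← b4]
    have b6 : ∀ (c : ℂ) (u : Fin (s + 1) → E),
        altSum (fun u : Fin (s + 1) → E => c * S (u 0) (Fin.tail u)) u = 0 := by
      intro c u
      rw [altSum_const_mul, ← factorial_mul_alternatizeUncurryFin, hS]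
      simp
    simp only [b6]
    simp [altSum]
  have h3 : altSum f v = 0 := (mul_eq_zero.mp h2).resolve_left (hc _)
  rw [h3] at h1
  refine (mul_eq_zero.mp h1).resolve_left ?_
  exact_mod_cast mul_ne_zero r.factorial_ne_zero s.factorial_ne_zero

end Alternatize

/-! ### Behaviour of forms under multiplication by `i` -/

section JWeight

variable {V : Type*} [AddCommGroup V] [Module ℂ V] [TopologicalSpace V]

/-- The form `α` is an eigenvector with eigenvalue `z` of the pullback by `v ↦ i v`. Forms of type
`(p,q)` are, with `z = i^p (-i)^q`. -/
def HasJWeight {r : ℕ} (z : ℂ) (α : V [⋀^Fin r]→L[ℝ] ℂ) : Prop :=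
  ∀ v : Fin r → V, α (fun i => Complex.I • v i) = z * α v

theorem HasJWeight.wedge {r s : ℕ} {z z' : ℂ} {α : V [⋀^Fin r]→L[ℝ] ℂ} {β : V [⋀^Fin s]→L[ℝ] ℂ}
    (hα : HasJWeight z α) (hβ : HasJWeight z' β) : HasJWeight (z * z') (wedge α β) := by
  intro v
  have h : ((r.factorial * s.factorial : ℕ) : ℂ) ≠ 0 := by
    exact_mod_cast mul_ne_zero r.factorial_ne_zero s.factorial_ne_zero
  apply mul_left_cancel₀ h
  rw [mul_left_comm, wedge_apply, wedge_apply, ← altSum_const_mul]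
  simp only [altSum]
  refine Finset.sum_congr rfl fun σ _ => ?_
  have h1 := hα ((v ∘ σ) ∘ Fin.castAdd s)
  have h2 := hβ ((v ∘ σ) ∘ Fin.natAdd r)
  have h3 : ((fun i => Complex.I • v i) ∘ σ) ∘ Fin.castAdd s =
    fun i => Complex.I • ((v ∘ σ) ∘ Fin.castAdd s) i := rfl
  have h4 : ((fun i => Complex.I • v i) ∘ σ) ∘ Fin.natAdd r =
    fun i => Complex.I • ((v ∘ σ) ∘ Fin.natAdd r) i := rfl
  rw [h3, h4, h1, h2]
  ring

theorem HasJWeight.conjForm {r : ℕ} {z : ℂ} {α : V [⋀^Fin r]→L[ℝ] ℂ} (hα : HasJWeight z α) :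
    HasJWeight (starRingEnd ℂ z) (conjForm α) := by
  intro v
  change starRingEnd ℂ (α _) = _ * starRingEnd ℂ (α v)
  rw [hα, map_mul]

theorem HasJWeight.castDegree {r s : ℕ} (h : r = s) {z : ℂ} {α : V [⋀^Fin r]→L[ℝ] ℂ}
    (hα : HasJWeight z α) : HasJWeight z (castDegree h α) := by
  intro v
  exact hα _

theorem hasJWeight_wedgeCovectors {r : ℕ} (φ : Fin r → V →L[ℂ] ℂ) :
    HasJWeight (Complex.I ^ r) (wedgeCovectors φ) := by
  intro v
  change Matrix.det _ = _ * Matrix.det _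
  have : (Matrix.of fun i j => φ j (Complex.I • v i)) =
      Complex.I • Matrix.of fun i j => φ j (v i) := by
    ext i j
    simp
  rw [this, Matrix.det_smul, Fintype.card_fin]

theorem hasJWeight_of_mem_typeForms {p q r : ℕ} {α : V [⋀^Fin r]→L[ℝ] ℂ}
    (hα : α ∈ typeForms V p q r) : HasJWeight (Complex.I ^ p * (-Complex.I) ^ q) α := by
  induction hα using Submodule.span_induction with
  | mem α h =>
    obtain ⟨h, φ, ψ, rfl⟩ := h
    have := ((hasJWeight_wedgeCovectors φ).wedge
      (hasJWeight_wedgeCovectors ψ).conjForm).castDegree h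
    simpa using this
  | zero => intro v; simp
  | add α β _ _ h1 h2 => intro v; simp [h1 v, h2 v, mul_add]
  | smul c α _ h => intro v; simp [h v, mul_left_comm]

theorem HasJWeight.compContinuousLinearMap {W : Type*} [AddCommGroup W] [Module ℂ W]
    [TopologicalSpace W] {r : ℕ} {z : ℂ} {α : V [⋀^Fin r]→L[ℝ] ℂ} (hα : HasJWeight z α)
    (L : W →L[ℂ] V) : HasJWeight z (α.compContinuousLinearMap (L.restrictScalars ℝ)) := by
  intro v
  have := hα (fun i => L (v i))
  simpa [Function.comp_def] using this

end JWeight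

/-! ### Forms of top degree -/

section TopDegree

variable {V : Type*} [AddCommGroup V] [Module ℝ V]

/-- A form of top degree is determined by its value on a basis. -/
theorem topForm_apply {ι : Type*} [Fintype ι] [DecidableEq ι] (e : Module.Basis ι ℝ V)
    (g : V [⋀^ι]→ₗ[ℝ] ℂ) (v : ι → V) : g v = (e.det v : ℂ) * g e := by
  have hre := congrArg (fun h => h v)
    (AlternatingMap.eq_smul_basis_det e (Complex.reLm.compAlternatingMap g))
  have him := congrArg (fun h => h v)
    (AlternatingMap.eq_smul_basis_det e (Complex.imLm.compAlternatingMap g))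
  simp only [LinearMap.compAlternatingMap_apply, AlternatingMap.smul_apply, smul_eq_mul,
    Complex.reLm_coe, Complex.imLm_coe] at hre him
  apply Complex.ext
  · rw [hre]; simp [mul_comm]
  · rw [him]; simp [mul_comm]

theorem topForm_comp_linearMap {ι : Type*} [Fintype ι] [DecidableEq ι] (e : Module.Basis ι ℝ V)
    (g : V [⋀^ι]→ₗ[ℝ] ℂ) (L : V →ₗ[ℝ] V) :
    g (fun i => L (e i)) = ((LinearMap.det L : ℝ) : ℂ) * g e := by
  rw [topForm_apply e]
  congr 2
  have := e.det_comp L e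
  rw [Module.Basis.det_self, mul_one] at this
  exact this

end TopDegree

section RealDet

variable {V : Type*} [AddCommGroup V] [Module ℂ V]

theorem det_restrictScalars_complex (L : V →ₗ[ℂ] V) :
    LinearMap.det (L.restrictScalars ℝ) = Complex.normSq (LinearMap.det L) := by
  rw [LinearMap.det_restrictScalars, Algebra.norm_complex_apply]

/-- Multiplication by `i` has real determinant `1`, so a top degree form on which it acts by
another factor vanishes. -/
theorem HasJWeight.eq_zero [TopologicalSpace V] [FiniteDimensional ℂ V] {r : ℕ} {z : ℂ}
    {α : V [⋀^Fin r]→L[ℝ] ℂ} (hα : HasJWeight z α) (hz : z ≠ 1) (hr : Module.finrank ℝ V = r) :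
    α = 0 := by
  have e := Module.finBasisOfFinrankEq ℝ V hr
  have h1 := topForm_comp_linearMap e α.toAlternatingMap
    ((Complex.I • (LinearMap.id : V →ₗ[ℂ] V)).restrictScalars ℝ)
  have h2 : α (fun i => Complex.I • e i) =
      (Complex.normSq (LinearMap.det (Complex.I • (LinearMap.id : V →ₗ[ℂ] V))) : ℂ) * α e := by
    rw [← det_restrictScalars_complex]; exact h1
  rw [hα, LinearMap.det_smul] at h2
  simp only [LinearMap.det_id, mul_one, map_pow, Complex.normSq_I, one_pow, Complex.ofReal_one,
    one_mul] at h2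
  have h3 : α e = 0 := by
    have : (z - 1) * α e = 0 := by rw [sub_mul, h2, one_mul, sub_self]
    exact (mul_eq_zero.mp this).resolve_left (sub_ne_zero.mpr hz)
  ext v
  have := topForm_apply e α.toAlternatingMap v
  change α v = _ * α e at this
  rw [this, h3]
  simp

end RealDet

/-! ### The volume form does not vanish -/

section VolForm

variable {V : Type*} [AddCommGroup V] [Module ℂ V] [TopologicalSpace V]

/-- If two forms are the signed sums of `f` and `g`, then their wedge product is the signed sum of
the product of `f` and `g` in separate variables. -/
theorem wedge_apply_of_altSum {r s : ℕ} (α : V [⋀^Fin r]→L[ℝ] ℂ) (β : V [⋀^Fin s]→L[ℝ] ℂ)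
    (f : (Fin r → V) → ℂ) (g : (Fin s → V) → ℂ) (hf : ∀ v, α v = altSum f v)
    (hg : ∀ v, β v = altSum g v) (v : Fin (r + s) → V) :
    wedge α β v = altSum (fun w => f (w ∘ Fin.castAdd s) * g (w ∘ Fin.natAdd r)) v := by
  have hc : ((r.factorial * s.factorial : ℕ) : ℂ) ≠ 0 := by
    exact_mod_cast mul_ne_zero r.factorial_ne_zero s.factorial_ne_zero
  apply mul_left_cancel₀ hc
  rw [wedge_apply]
  have hdis : ∀ (i : Fin s) , Fin.natAdd r i ∉ Set.range (Fin.castAddEmb s : Fin r ↪ _) := by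
    rintro i ⟨k, hk⟩
    have := congrArg Fin.val hk
    simp at this
    omega
  have hdis' : ∀ (i : Fin r) , Fin.castAdd s i ∉ Set.range (Fin.natAddEmb r : Fin s ↪ _) := by
    rintro i ⟨k, hk⟩
    have := congrArg Fin.val hk
    simp at this
    omega
  have h1 := altSum_altSum (Fin.castAddEmb s : Fin r ↪ Fin (r + s))
    (fun w u => β (w ∘ Fin.natAdd r) * f u) (by
      intro w w' hw
      have : w ∘ Fin.natAdd r = w' ∘ Fin.natAdd r := by
        funext i
        exact hw _ (hdis i)
      simp [this]) v
  have h2 := altSum_altSum (Fin.natAddEmb r : Fin s ↪ Fin (r + s))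
    (fun w u => f (w ∘ Fin.castAdd s) * g u) (by
      intro w w' hw
      have : w ∘ Fin.castAdd s = w' ∘ Fin.castAdd s := by
        funext i
        exact hw _ (hdis' i)
      simp [this]) v
  simp only [altSum_const_mul, Fintype.card_fin, Fin.coe_castAddEmb, ← hf,
    ← hg] at h1 h2
  change altSum (fun w => f (w ∘ Fin.castAdd s) * β (w ∘ Fin.natAdd r)) v =
    _ * altSum (fun w => f (w ∘ Fin.castAdd s) * g (w ∘ Fin.natAdd r)) v at h2
  simp only [fun w : Fin (r + s) → V => mul_comm (α (w ∘ Fin.castAdd s)) (β (w ∘ Fin.natAdd r))]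
  rw [h1]
  simp only [fun w : Fin (r + s) → V => mul_comm (β (w ∘ Fin.natAdd r)) (f (w ∘ Fin.castAdd s))]
  rw [h2]
  push_cast
  ring

/-- `φ^1 ∧ ⋯ ∧ φ^n ∧ conj φ^1 ∧ ⋯ ∧ conj φ^n` is the determinant of the `2n` functions involved. -/
theorem wedge_wedgeCovectors_conjForm_apply {n : ℕ} (φ : Fin n → V →L[ℂ] ℂ)
    (v : Fin n ⊕ Fin n → V) :
    wedge (wedgeCovectors φ) (conjForm (wedgeCovectors φ)) (v ∘ finSumFinEquiv.symm) =
      Matrix.det (Matrix.of fun i j =>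
        Sum.elim (fun k w => φ k w) (fun k w => starRingEnd ℂ (φ k w)) j (v i)) := by
  rw [wedge_apply_of_altSum _ _ (fun w => ∏ i, φ i (w i))
    (fun w => ∏ i, starRingEnd ℂ (φ i (w i))) (wedgeCovectors_apply φ), ← altSum_prod_eq_det]
  · have := altSum_comp_equiv (finSumFinEquiv : Fin n ⊕ Fin n ≃ _) (fun w : Fin n ⊕ Fin n → V =>
      ∏ i, Sum.elim (fun k w => φ k w) (fun k w => starRingEnd ℂ (φ k w)) i (w i))
      (v ∘ finSumFinEquiv.symm)
    rw [show (v ∘ finSumFinEquiv.symm) ∘ finSumFinEquiv = v by funext; simp] at this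
    rw [← this]
    congr 1
    funext w
    simp
  · intro w
    change starRingEnd ℂ (wedgeCovectors φ w) = _
    rw [wedgeCovectors_apply, altSum, altSum, map_sum]
    exact Finset.sum_congr rfl fun σ _ => by simp [map_prod]

end VolForm

theorem sigmaConst_ne_zero (m : ℕ) : sigmaConst m ≠ 0 := by
  simp [sigmaConst]

theorem volForm_ne_zero {E : Type*} [NormedAddCommGroup E] [NormedSpace ℂ E]
    [FiniteDimensional ℂ E] {n : ℕ} (φ : Module.Basis (Fin n) ℂ (E →L[ℂ] ℂ)) : volForm φ ≠ 0 := by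
  intro h0
  have h : wedge (wedgeCovectors φ) (conjForm (wedgeCovectors φ)) = 0 :=
    (smul_eq_zero.mp h0).resolve_left (sigmaConst_ne_zero n)
  let φ' : Module.Basis (Fin n) ℂ (Module.Dual ℂ E) :=
    φ.map (LinearMap.toContinuousLinearMap : (E →ₗ[ℂ] ℂ) ≃ₗ[ℂ] (E →L[ℂ] ℂ)).symm
  let e : Fin n → E := fun j => (Module.evalEquiv ℂ E).symm (φ'.dualBasis j)
  have he : ∀ i j, φ i (e j) = if i = j then 1 else 0 := by
    intro i j
    have h1 : φ i (e j) = φ' i (e j) := by simp [φ']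
    have h2 : φ' i (e j) = φ'.dualBasis j (φ' i) := by
      simp [e]
    rw [h1, h2, Module.Basis.dualBasis_apply_self]
  -- evaluate on the basis dual to `φ` and its multiple by `i`
  have hd := wedge_wedgeCovectors_conjForm_apply φ (Sum.elim e (fun j => Complex.I • e j))
  rw [h] at hd
  have hM : (Matrix.of fun i j => Sum.elim (fun k w => φ k w)
      (fun k w => starRingEnd ℂ (φ k w)) j (Sum.elim e (fun j => Complex.I • e j) i)) =
      Matrix.fromBlocks 1 1 (Complex.I • (1 : Matrix (Fin n) (Fin n) ℂ))
        (-Complex.I • (1 : Matrix (Fin n) (Fin n) ℂ)) := by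
    ext i j
    rcases i with i | i <;> rcases j with j | j <;>
      simp [he, Matrix.one_apply, eq_comm, apply_ite]
  rw [hM, Matrix.det_fromBlocks_one₁₁, mul_one, ← sub_smul, Matrix.det_smul] at hd
  simp only [Matrix.det_one, mul_one] at hd
  refine pow_ne_zero _ ?_ hd.symm
  intro h
  have := congrArg Complex.im h
  norm_num at this

/-! ### Wedge products of differential forms on a vector space -/

section Bilinear

variable {V : Type*} [AddCommGroup V] [Module ℂ V] [TopologicalSpace V]

/-- A form is a wedge product if it agrees with the signed sum over all permutations. -/
theorem wedge_ext {r s : ℕ} {α : V [⋀^Fin r]→L[ℝ] ℂ} {β : V [⋀^Fin s]→L[ℝ] ℂ}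
    {γ : V [⋀^Fin (r + s)]→L[ℝ] ℂ}
    (h : ∀ v, altSum (fun w => α (w ∘ Fin.castAdd s) * β (w ∘ Fin.natAdd r)) v =
      ((r.factorial * s.factorial : ℕ) : ℂ) * γ v) : wedge α β = γ := by
  ext v
  have hc : ((r.factorial * s.factorial : ℕ) : ℂ) ≠ 0 := by
    exact_mod_cast mul_ne_zero r.factorial_ne_zero s.factorial_ne_zero
  exact mul_left_cancel₀ hc ((wedge_apply α β v).trans (h v))

theorem wedge_add_left {r s : ℕ} (α α' : V [⋀^Fin r]→L[ℝ] ℂ) (β : V [⋀^Fin s]→L[ℝ] ℂ) :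
    wedge (α + α') β = wedge α β + wedge α' β := by
  refine wedge_ext fun v => ?_
  rw [ContinuousAlternatingMap.add_apply, mul_add, wedge_apply, wedge_apply]
  simp only [altSum, ← Finset.sum_add_distrib]
  exact Finset.sum_congr rfl fun σ _ => by rw [ContinuousAlternatingMap.add_apply]; ring

theorem wedge_add_right {r s : ℕ} (α : V [⋀^Fin r]→L[ℝ] ℂ) (β β' : V [⋀^Fin s]→L[ℝ] ℂ) :
    wedge α (β + β') = wedge α β + wedge α β' := by
  refine wedge_ext fun v => ?_
  rw [ContinuousAlternatingMap.add_apply, mul_add, wedge_apply, wedge_apply]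
  simp only [altSum, ← Finset.sum_add_distrib]
  exact Finset.sum_congr rfl fun σ _ => by rw [ContinuousAlternatingMap.add_apply]; ring

theorem wedge_smul_left {r s : ℕ} (c : ℝ) (α : V [⋀^Fin r]→L[ℝ] ℂ) (β : V [⋀^Fin s]→L[ℝ] ℂ) :
    wedge (c • α) β = c • wedge α β := by
  refine wedge_ext fun v => ?_
  rw [ContinuousAlternatingMap.smul_apply, Complex.real_smul, mul_left_comm, wedge_apply,
    ← altSum_const_mul]
  congr 1
  funext w
  rw [ContinuousAlternatingMap.smul_apply, Complex.real_smul, mul_assoc]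

theorem wedge_smul_right {r s : ℕ} (c : ℝ) (α : V [⋀^Fin r]→L[ℝ] ℂ) (β : V [⋀^Fin s]→L[ℝ] ℂ) :
    wedge α (c • β) = c • wedge α β := by
  refine wedge_ext fun v => ?_
  rw [ContinuousAlternatingMap.smul_apply, Complex.real_smul, mul_left_comm, wedge_apply,
    ← altSum_const_mul]
  congr 1
  funext w
  rw [ContinuousAlternatingMap.smul_apply, Complex.real_smul, mul_left_comm]

theorem wedge_compContinuousLinearMap {W : Type*} [AddCommGroup W] [Module ℂ W]
    [TopologicalSpace W] {r s : ℕ} (α : V [⋀^Fin r]→L[ℝ] ℂ) (β : V [⋀^Fin s]→L[ℝ] ℂ)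
    (L : W →L[ℝ] V) : wedge (α.compContinuousLinearMap L) (β.compContinuousLinearMap L) =
      (wedge α β).compContinuousLinearMap L := by
  refine wedge_ext fun v => ?_
  rw [ContinuousAlternatingMap.compContinuousLinearMap_apply, wedge_apply]
  rfl

theorem castDegree_zero {r s : ℕ} (h : r = s) : castDegree h (0 : V [⋀^Fin r]→L[ℝ] ℂ) = 0 := rfl

theorem wedge_zero_left {r s : ℕ} (β : V [⋀^Fin s]→L[ℝ] ℂ) :
    wedge (0 : V [⋀^Fin r]→L[ℝ] ℂ) β = 0 :=
  wedge_ext fun v => by simp [altSum]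

theorem wedge_zero_right {r s : ℕ} (α : V [⋀^Fin r]→L[ℝ] ℂ) :
    wedge α (0 : V [⋀^Fin s]→L[ℝ] ℂ) = 0 :=
  wedge_ext fun v => by simp [altSum]

theorem wedge_castDegree_left {r r' s : ℕ} (h : r = r') (α : V [⋀^Fin r]→L[ℝ] ℂ)
    (β : V [⋀^Fin s]→L[ℝ] ℂ) :
    wedge (castDegree h α) β = castDegree (by rw [h]) (wedge α β) := by
  subst h
  rfl

theorem castDegree_castDegree {r s t : ℕ} (h : r = s) (h' : s = t) (α : V [⋀^Fin r]→L[ℝ] ℂ) :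
    castDegree h' (castDegree h α) = castDegree (h.trans h') α := rfl

end Bilinear

section Calculus

theorem HasJWeight.alternatizeUncurryFin {E : Type*} [NormedAddCommGroup E] [NormedSpace ℂ E]
    {r : ℕ} {z c : ℂ} {T : E →L[ℝ] E [⋀^Fin r]→L[ℝ] ℂ}
    (hT : ∀ u, HasJWeight z (T u)) (hc : ∀ u v, T (Complex.I • u) v = c * T u v) :
    HasJWeight (c * z) (ContinuousAlternatingMap.alternatizeUncurryFin T) := by
  intro v
  rw [ContinuousAlternatingMap.alternatizeUncurryFin_apply,
    ContinuousAlternatingMap.alternatizeUncurryFin_apply, Finset.mul_sum]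
  refine Finset.sum_congr rfl fun i _ => ?_
  have h := hT (v i) (i.removeNth v)
  rw [hc, mul_smul_comm, mul_assoc, ← h]
  rfl

variable {E : Type*} [NormedAddCommGroup E] [NormedSpace ℂ E] [FiniteDimensional ℂ E]

instance finite_continuousAlternatingMap (r : ℕ) : Module.Finite ℝ (E [⋀^Fin r]→L[ℝ] ℂ) := by
  let f : (E [⋀^Fin r]→L[ℝ] ℂ) →ₗ[ℝ] MultilinearMap ℝ (fun _ : Fin r => E) ℂ :=
    { toFun := fun α => α.toMultilinearMap
      map_add' := fun _ _ => rfl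
      map_smul' := fun _ _ => rfl }
  refine Module.Finite.of_injective f fun α β h => ?_
  ext v
  exact congrArg (fun g : MultilinearMap ℝ (fun _ : Fin r => E) ℂ => g v) h

/-- The wedge product as a continuous bilinear map. -/
def wedgeCLM (E : Type*) [NormedAddCommGroup E] [NormedSpace ℂ E] [FiniteDimensional ℂ E]
    (r s : ℕ) : (E [⋀^Fin r]→L[ℝ] ℂ) →L[ℝ] (E [⋀^Fin s]→L[ℝ] ℂ) →L[ℝ]
      E [⋀^Fin (r + s)]→L[ℝ] ℂ :=
  LinearMap.toContinuousLinearMap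
    { toFun := fun α => LinearMap.toContinuousLinearMap
        { toFun := fun β => wedge α β
          map_add' := wedge_add_right α
          map_smul' := fun c β => wedge_smul_right c α β }
      map_add' := fun α α' => by ext1 β; exact wedge_add_left α α' β
      map_smul' := fun c α => by ext1 β; exact wedge_smul_left c α β }

@[simp]
theorem wedgeCLM_apply {r s : ℕ} (α : E [⋀^Fin r]→L[ℝ] ℂ) (β : E [⋀^Fin s]→L[ℝ] ℂ) :
    wedgeCLM E r s α β = wedge α β := rfl

/-- Complex conjugation of forms as a continuous linear map. -/
def conjFormCLM (E : Type*) [NormedAddCommGroup E] [NormedSpace ℂ E] [FiniteDimensional ℂ E]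
    (r : ℕ) : (E [⋀^Fin r]→L[ℝ] ℂ) →L[ℝ] E [⋀^Fin r]→L[ℝ] ℂ :=
  LinearMap.toContinuousLinearMap
    { toFun := conjForm
      map_add' := fun α β => by ext v; exact map_add (starRingEnd ℂ) (α v) (β v)
      map_smul' := fun c α => by
        ext v
        exact map_smul (Complex.conjCLE : ℂ →L[ℝ] ℂ) c (α v) }

theorem extDeriv_wedge {r s : ℕ} {α : E → E [⋀^Fin r]→L[ℝ] ℂ} {β : E → E [⋀^Fin s]→L[ℝ] ℂ} {y : E}
    (hα : DifferentiableAt ℝ α y) (hβ : DifferentiableAt ℝ β y) (hd : extDeriv β y = 0)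
    (h : r + 1 + s = r + s + 1) :
    extDeriv (fun z => wedge (α z) (β z)) y = castDegree h (wedge (extDeriv α y) (β y)) := by
  have hf := (wedgeCLM E r s).fderiv_of_bilinear hα hβ
  simp only [wedgeCLM_apply] at hf
  rw [extDeriv, hf, ContinuousAlternatingMap.alternatizeUncurryFin_add,
    alternatizeUncurryFin_wedge_right (fderiv ℝ β y) (α y) _ (fun v => by simp) hd, zero_add,
    alternatizeUncurryFin_wedge_left (fderiv ℝ α y) (β y) _ (fun v => by simp) h]
  rfl

theorem extDeriv_conjForm {r : ℕ} {α : E → E [⋀^Fin r]→L[ℝ] ℂ} {y : E}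
    (hα : DifferentiableAt ℝ α y) :
    extDeriv (fun z => conjForm (α z)) y = conjForm (extDeriv α y) := by
  have hf : fderiv ℝ (fun z => conjForm (α z)) y = (conjFormCLM E r).comp (fderiv ℝ α y) :=
    ((conjFormCLM E r).hasFDerivAt.comp y hα.hasFDerivAt).fderiv
  rw [extDeriv, hf, extDeriv]
  ext v
  change _ = starRingEnd ℂ (ContinuousAlternatingMap.alternatizeUncurryFin (fderiv ℝ α y) v)
  rw [ContinuousAlternatingMap.alternatizeUncurryFin_apply,
    ContinuousAlternatingMap.alternatizeUncurryFin_apply, map_sum]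
  refine Finset.sum_congr rfl fun i _ => ?_
  rcases neg_one_pow_eq_or ℤ (i : ℕ) with h | h <;> simp [h] <;> rfl

theorem HasJWeight.fderiv {r : ℕ} {z : ℂ} {η : E → E [⋀^Fin r]→L[ℝ] ℂ} {y : E}
    (hη : DifferentiableAt ℝ η y) (hz : ∀ᶠ x in nhds y, HasJWeight z (η x)) (u : E) :
    HasJWeight z (fderiv ℝ η y u) := by
  intro v
  let ev : (Fin r → E) → (E [⋀^Fin r]→L[ℝ] ℂ) →L[ℝ] ℂ := fun w =>
    LinearMap.toContinuousLinearMap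
      { toFun := fun α => α w, map_add' := fun _ _ => rfl, map_smul' := fun _ _ => rfl }
  have h : ∀ w, HasFDerivAt (fun x => η x w) ((ev w).comp (_root_.fderiv ℝ η y)) y := fun w =>
    (ev w).hasFDerivAt.comp y hη.hasFDerivAt
  have h1 := h (fun i => Complex.I • v i)
  have h2 := (h v).const_mul z
  have h3 : (fun x => η x (fun i => Complex.I • v i)) =ᶠ[nhds y] fun x => z * η x v :=
    hz.mono fun x hx => hx v
  have h4 := (h1.congr_of_eventuallyEq h3.symm).unique h2
  exact congrArg (fun L : E →L[ℝ] ℂ => L u) h4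

/-- The operator `∂` raises the first index of the type by one. -/
theorem HasJWeight.delCoord {r : ℕ} {z : ℂ} {η : E → E [⋀^Fin r]→L[ℝ] ℂ} {y : E}
    (hη : DifferentiableAt ℝ η y) (hz : ∀ᶠ x in nhds y, HasJWeight z (η x)) :
    HasJWeight (Complex.I * z) (delCoord η y) := by
  have h := HasJWeight.fderiv hη hz
  refine HasJWeight.alternatizeUncurryFin (fun u v => ?_) fun u v => ?_
  · have h1 := h u v
    have h2 := h (Complex.I • u) v
    simp [linearPart, h1, h2]
    ring
  · simp only [linearPart, smul_apply, ContinuousAlternatingMap.smul_apply,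
      sub_apply, ContinuousAlternatingMap.sub_apply, smul_eq_mul,
      ContinuousLinearMap.comp_apply, ContinuousLinearMap.coe_restrictScalars',
      ContinuousLinearMap.id_apply, smul_smul, Complex.I_mul_I, map_neg, neg_smul, one_smul,
      ContinuousAlternatingMap.neg_apply]
    linear_combination (1 / 2) * (_root_.fderiv ℝ η y (Complex.I • u) v) * (Complex.I_mul_I)

/-- The operator `∂bar` raises the second index of the type by one. -/
theorem HasJWeight.delbarCoord {r : ℕ} {z : ℂ} {η : E → E [⋀^Fin r]→L[ℝ] ℂ} {y : E}
    (hη : DifferentiableAt ℝ η y) (hz : ∀ᶠ x in nhds y, HasJWeight z (η x)) :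
    HasJWeight (-Complex.I * z) (delbarCoord η y) := by
  have h := HasJWeight.fderiv hη hz
  refine HasJWeight.alternatizeUncurryFin (fun u v => ?_) fun u v => ?_
  · have h1 := h u v
    have h2 := h (Complex.I • u) v
    simp [antilinearPart, h1, h2]
    ring
  · simp only [antilinearPart, smul_apply, ContinuousAlternatingMap.smul_apply,
      add_apply, ContinuousAlternatingMap.add_apply, smul_eq_mul,
      ContinuousLinearMap.comp_apply, ContinuousLinearMap.coe_restrictScalars',
      ContinuousLinearMap.id_apply, smul_smul, Complex.I_mul_I, map_neg, neg_smul, one_smul,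
      ContinuousAlternatingMap.neg_apply]
    linear_combination (1 / 2) * (_root_.fderiv ℝ η y (Complex.I • u) v) * (Complex.I_mul_I)

/-- If `a`, `b`, `ξ` have types `(q,q+1)`, `(q+1,q)`, `(k,0)`, if `ξ` is closed at `y` and the real
dimension is `2(q+1+k)`, then `d((a + b) ∧ ξ ∧ conj ξ) = (∂a + ∂bar b) ∧ ξ ∧ conj ξ` at `y`: the
terms with `∂bar a` and `∂b` have type `(n-1,n+1)` and `(n+1,n-1)`, hence vanish. -/
theorem extDeriv_wedge_wedge_conjForm {q k s : ℕ} {a b : E → E [⋀^Fin s]→L[ℝ] ℂ}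
    {ξ : E → E [⋀^Fin k]→L[ℝ] ℂ} {y : E} (ha : DifferentiableAt ℝ a y)
    (hb : DifferentiableAt ℝ b y) (hξ : DifferentiableAt ℝ ξ y)
    (hza : ∀ᶠ x in nhds y, HasJWeight (Complex.I ^ q * (-Complex.I) ^ (q + 1)) (a x))
    (hzb : ∀ᶠ x in nhds y, HasJWeight (Complex.I ^ (q + 1) * (-Complex.I) ^ q) (b x))
    (hzξ : HasJWeight (Complex.I ^ k) (ξ y)) (hd : delCoord ξ y = 0) (hdbar : delbarCoord ξ y = 0)
    (hE : Module.finrank ℝ E = s + 1 + k + k) (h : s + 1 + k + k = s + k + k + 1) :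
    extDeriv (fun x => wedge (wedge (a x + b x) (ξ x)) (conjForm (ξ x))) y =
      castDegree h (wedge (wedge (delCoord a y + delbarCoord b y) (ξ y)) (conjForm (ξ y))) := by
  have hdξ : extDeriv ξ y = 0 := by rw [← delCoord_add_delbarCoord, hd, hdbar, add_zero]
  have hξ' : DifferentiableAt ℝ (fun x => conjForm (ξ x)) y :=
    (conjFormCLM E k).differentiableAt.comp y hξ
  have hdξ' : extDeriv (fun x => conjForm (ξ x)) y = 0 := by
    rw [extDeriv_conjForm hξ, hdξ]
    ext v
    exact map_zero (starRingEnd ℂ)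
  have hab : DifferentiableAt ℝ (fun x => wedge (a x + b x) (ξ x)) y :=
    ((wedgeCLM E s k).hasFDerivAt_of_bilinear (ha.fun_add hb).hasFDerivAt
      hξ.hasFDerivAt).differentiableAt
  have hI : Complex.I * -Complex.I = 1 := by simp
  -- a term of eigenvalue `-1` under `i` gives a top degree form of eigenvalue `-1`, hence zero
  have key : ∀ (z : ℂ) (τ : E [⋀^Fin (s + 1)]→L[ℝ] ℂ), HasJWeight z τ → z = -1 →
      wedge (wedge τ (ξ y)) (conjForm (ξ y)) = 0 := by
    rintro z τ hτ rfl
    refine ((hτ.wedge hzξ).wedge hzξ.conjForm).eq_zero ?_ hE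
    rw [map_pow, Complex.conj_I, mul_assoc, ← mul_pow, hI]
    norm_num
  have hq : Complex.I ^ q * (-Complex.I) ^ q = 1 := by rw [← mul_pow, hI, one_pow]
  have k1 := key _ _ (HasJWeight.delbarCoord ha hza) (by
    rw [pow_succ]
    linear_combination (Complex.I * Complex.I) * hq + Complex.I_mul_I)
  have k2 := key _ _ (HasJWeight.delCoord hb hzb) (by
    rw [pow_succ]
    linear_combination (Complex.I * Complex.I) * hq + Complex.I_mul_I)
  rw [extDeriv_wedge hab hξ' hdξ' (by omega), extDeriv_wedge (ha.fun_add hb) hξ hdξ (by omega),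
    show extDeriv (fun x => a x + b x) y = _ from extDeriv_add ha hb,
    ← delCoord_add_delbarCoord, ← delCoord_add_delbarCoord]
  have hsum : wedge (wedge (delCoord a y + delbarCoord a y + (delCoord b y + delbarCoord b y))
      (ξ y)) (conjForm (ξ y)) =
      wedge (wedge (delCoord a y + delbarCoord b y) (ξ y)) (conjForm (ξ y)) := by
    simp only [wedge_add_left, k1, k2]
    abel
  rw [← hsum, wedge_castDegree_left, castDegree_castDegree]

end Calculus

/-! ### Forms in charts -/

section Charts

open Set

variable {E : Type*} [NormedAddCommGroup E] [NormedSpace ℂ E]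
  {M : Type*} [TopologicalSpace M] [ChartedSpace E M] [IsManifold 𝓘(ℂ, E) ω M]

/-- The underlying smooth real manifold, with the same charts. -/
theorem isManifold_real (E : Type*) [NormedAddCommGroup E] [NormedSpace ℂ E]
    (M : Type*) [TopologicalSpace M] [ChartedSpace E M] [IsManifold 𝓘(ℂ, E) ω M] :
    IsManifold 𝓘(ℝ, E) ∞ M := by
  refine isManifold_of_contDiffOn 𝓘(ℝ, E) ∞ M fun e e' he he' => ?_
  have h := (contDiffGroupoid ω 𝓘(ℂ, E)).compatible he he'
  rw [contDiffGroupoid, mem_groupoid_of_pregroupoid] at h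
  exact (ContDiffOn.restrict_scalars ℝ h.1).of_le le_top

/-- The transition map from the chart at `x₀` to the chart at `x₁`. -/
def transition (E : Type*) [NormedAddCommGroup E] [NormedSpace ℂ E]
    {M : Type*} [TopologicalSpace M] [ChartedSpace E M] (x₀ x₁ : M) : E → E :=
  extChartAt 𝓘(ℂ, E) x₁ ∘ (extChartAt 𝓘(ℂ, E) x₀).symm

/-- The part of the target of the chart at `x₀` which corresponds to the source of the chart at
`x₁`. -/
def overlap (E : Type*) [NormedAddCommGroup E] [NormedSpace ℂ E]
    {M : Type*} [TopologicalSpace M] [ChartedSpace E M] (x₀ x₁ : M) : Set E :=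
  (extChartAt 𝓘(ℂ, E) x₀).target ∩
    (extChartAt 𝓘(ℂ, E) x₀).symm ⁻¹' (extChartAt 𝓘(ℂ, E) x₁).source

omit [IsManifold 𝓘(ℂ, E) ω M] in
theorem isOpen_overlap (x₀ x₁ : M) : IsOpen (overlap E x₀ x₁) :=
  (continuousOn_extChartAt_symm x₀).isOpen_inter_preimage (isOpen_extChartAt_target x₀)
    (isOpen_extChartAt_source x₁)

omit [IsManifold 𝓘(ℂ, E) ω M] in
theorem transition_mem_overlap {x₀ x₁ : M} {y : E} (hy : y ∈ overlap E x₀ x₁) :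
    transition E x₀ x₁ y ∈ overlap E x₁ x₀ := by
  refine ⟨(extChartAt 𝓘(ℂ, E) x₁).map_source hy.2, ?_⟩
  rw [mem_preimage, transition, Function.comp_apply, (extChartAt 𝓘(ℂ, E) x₁).left_inv hy.2]
  exact (extChartAt 𝓘(ℂ, E) x₀).map_target hy.1

omit [IsManifold 𝓘(ℂ, E) ω M] in
theorem symm_transition {x₀ x₁ : M} {y : E} (hy : y ∈ overlap E x₀ x₁) :
    (extChartAt 𝓘(ℂ, E) x₁).symm (transition E x₀ x₁ y) = (extChartAt 𝓘(ℂ, E) x₀).symm y :=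
  (extChartAt 𝓘(ℂ, E) x₁).left_inv hy.2

omit [IsManifold 𝓘(ℂ, E) ω M] in
theorem transition_transition {x₀ x₁ : M} {y : E} (hy : y ∈ overlap E x₀ x₁) :
    transition E x₁ x₀ (transition E x₀ x₁ y) = y := by
  rw [transition, Function.comp_apply, symm_transition hy]
  exact (extChartAt 𝓘(ℂ, E) x₀).right_inv hy.1

theorem contDiffAt_transition {x₀ x₁ : M} {y : E} (hy : y ∈ overlap E x₀ x₁) :
    ContDiffAt ℂ ω (transition E x₀ x₁) y := by
  have h := contDiffOn_ext_coord_change (I := 𝓘(ℂ, E)) (n := ω) x₁ x₀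
  refine h.contDiffAt ((isOpen_overlap x₀ x₁).mem_nhds hy)

theorem fderiv_transition {x₀ x₁ : M} {y : E} (hy : y ∈ overlap E x₀ x₁) :
    fderiv ℝ (transition E x₀ x₁) y = (fderiv ℂ (transition E x₀ x₁) y).restrictScalars ℝ :=
  (((contDiffAt_transition hy).differentiableAt (by simp)).hasFDerivAt.restrictScalars ℝ).fderiv

/-- Transition maps are holomorphic, hence preserve the orientation. -/
theorem det_fderiv_transition_nonneg [FiniteDimensional ℂ E] {x₀ x₁ : M} {y : E}
    (hy : y ∈ overlap E x₀ x₁) : 0 ≤ (fderiv ℝ (transition E x₀ x₁) y).det := by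
  rw [fderiv_transition hy]
  exact (Complex.normSq_nonneg _).trans_eq
    (det_restrictScalars_complex (fderiv ℂ (transition E x₀ x₁) y).toLinearMap).symm

/-- Change of charts for the expression of a form in charts. -/
theorem inChart_eq_of_mem_overlap {r : ℕ} (η : DiffForm E M r) {x₀ x₁ : M} {y : E}
    (hy : y ∈ overlap E x₀ x₁) :
    inChart η x₀ y = (inChart η x₁ (transition E x₀ x₁ y)).compContinuousLinearMap
      (fderiv ℝ (transition E x₀ x₁) y) := by
  have hM : IsManifold 𝓘(ℂ, E) 1 M := IsManifold.of_le (n := ω) le_top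
  have hmd : ∀ (x : M) {z : E}, z ∈ (extChartAt 𝓘(ℂ, E) x).target →
      MDifferentiableAt 𝓘(ℂ, E) 𝓘(ℂ, E) (extChartAt 𝓘(ℂ, E) x).symm z := fun x z hz =>
    (mdifferentiableOn_extChartAt_symm z hz).mdifferentiableAt
      ((isOpen_extChartAt_target x).mem_nhds hz)
  have ht := transition_mem_overlap hy
  have hψ : MDifferentiableAt 𝓘(ℂ, E) 𝓘(ℂ, E) (transition E x₀ x₁) y :=
    ((contDiffAt_transition hy).differentiableAt (by simp)).mdifferentiableAt
  have hcomp : mfderiv 𝓘(ℂ, E) 𝓘(ℂ, E) (extChartAt 𝓘(ℂ, E) x₀).symm y =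
      (mfderiv 𝓘(ℂ, E) 𝓘(ℂ, E) (extChartAt 𝓘(ℂ, E) x₁).symm (transition E x₀ x₁ y)).comp
        (mfderiv 𝓘(ℂ, E) 𝓘(ℂ, E) (transition E x₀ x₁) y) := by
    rw [← mfderiv_comp y (hmd x₁ ht.1) hψ]
    refine Filter.EventuallyEq.mfderiv_eq ?_
    filter_upwards [(isOpen_overlap x₀ x₁).mem_nhds hy] with z hz
    exact (symm_transition hz).symm
  rw [fderiv_transition hy]
  -- equal base points have the same tangent space only up to transport, but all are the type `E`
  have hη : ∀ x x' : M, x = x' → ∀ v : Fin r → E,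
      (show E [⋀^Fin r]→L[ℝ] ℂ from η x) v = (show E [⋀^Fin r]→L[ℝ] ℂ from η x') v := by
    rintro x _ rfl v
    rfl
  ext v
  refine Eq.trans ?_ (hη _ _ (symm_transition hy).symm _)
  refine congrArg (fun w : Fin r → E =>
    (show E [⋀^Fin r]→L[ℝ] ℂ from η ((extChartAt 𝓘(ℂ, E) x₀).symm y)) w) ?_
  funext i
  have h := congrArg (fun L : E →L[ℂ] E => L (v i)) hcomp
  rw [mfderiv_eq_fderiv] at h
  exact h

/-- At the centre of a chart, the expression of a form in this chart is the form itself. -/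
theorem inChart_self {r : ℕ} (η : DiffForm E M r) (x : M) :
    inChart η x (extChartAt 𝓘(ℂ, E) x x) = η x := by
  have hM : IsManifold 𝓘(ℂ, E) 1 M := IsManifold.of_le (n := ω) le_top
  -- equal base points have the same tangent space only up to transport, but all are the type `E`
  have hη : ∀ x x' : M, x = x' → ∀ v : Fin r → E,
      (show E [⋀^Fin r]→L[ℝ] ℂ from η x) v = (show E [⋀^Fin r]→L[ℝ] ℂ from η x') v := by
    rintro x _ rfl v
    rfl
  have h := mfderivWithin_range_extChartAt_symm (I := 𝓘(ℂ, E)) (x := x)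
  rw [modelWithCornersSelf_coe, range_id, mfderivWithin_univ] at h
  ext v
  refine Eq.trans ?_ (hη _ _ (extChartAt_to_inv (I := 𝓘(ℂ, E)) x) _)
  refine congrArg (fun w : Fin r → E => (show E [⋀^Fin r]→L[ℝ] ℂ from
    η ((extChartAt 𝓘(ℂ, E) x).symm (extChartAt 𝓘(ℂ, E) x x))) w) ?_
  funext i
  exact congrArg (fun L : E →L[ℂ] E => L (v i)) h

theorem del_eq {r : ℕ} (η : DiffForm E M r) (x : M) :
    del η x = delCoord (inChart η x) (extChartAt 𝓘(ℂ, E) x x) := by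
  have hM : IsManifold 𝓘(ℂ, E) 1 M := IsManifold.of_le (n := ω) le_top
  rw [del, mfderiv_extChartAt_self]
  rfl

theorem delbar_eq {r : ℕ} (η : DiffForm E M r) (x : M) :
    delbar η x = delbarCoord (inChart η x) (extChartAt 𝓘(ℂ, E) x x) := by
  have hM : IsManifold 𝓘(ℂ, E) 1 M := IsManifold.of_le (n := ω) le_top
  rw [delbar, mfderiv_extChartAt_self]
  rfl

omit [IsManifold 𝓘(ℂ, E) ω M] in
theorem IsSmooth.contDiffAt {r : ℕ} {η : DiffForm E M r} (hη : IsSmooth η) {x : M} {y : E}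
    (hy : y ∈ (extChartAt 𝓘(ℂ, E) x).target) : ContDiffAt ℝ ∞ (inChart η x) y :=
  (hη x).contDiffAt ((isOpen_extChartAt_target x).mem_nhds hy)

theorem extDeriv_inChart_eq {r : ℕ} {η : DiffForm E M r} (hη : IsSmooth η) {x₀ x₁ : M} {y : E}
    (hy : y ∈ overlap E x₀ x₁) :
    extDeriv (inChart η x₀) y = (extDeriv (inChart η x₁)
      (transition E x₀ x₁ y)).compContinuousLinearMap (fderiv ℝ (transition E x₀ x₁) y) := by
  have h : inChart η x₀ =ᶠ[nhds y] fun z => (inChart η x₁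
      (transition E x₀ x₁ z)).compContinuousLinearMap (fderiv ℝ (transition E x₀ x₁) z) := by
    filter_upwards [(isOpen_overlap x₀ x₁).mem_nhds hy] with z hz
    exact inChart_eq_of_mem_overlap η hz
  rw [h.extDeriv_eq]
  refine extDeriv_pullback (r := ω) ?_ ((contDiffAt_transition hy).restrict_scalars ℝ) (by simp)
  exact (hη.contDiffAt (transition_mem_overlap hy).1).differentiableAt (by simp)

/-- The coefficient of the exterior derivative of a form of degree one less than the real dimension
changes by the Jacobian determinant under a change of charts. -/
theorem extDeriv_inChart_apply_eq {r : ℕ} {η : DiffForm E M r} (hη : IsSmooth η)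
    (e : Module.Basis (Fin (r + 1)) ℝ E) {x₀ x₁ : M} {y : E} (hy : y ∈ overlap E x₀ x₁) :
    extDeriv (inChart η x₀) y e = ((fderiv ℝ (transition E x₀ x₁) y).det : ℂ) *
      extDeriv (inChart η x₁) (transition E x₀ x₁ y) e := by
  rw [extDeriv_inChart_eq hη hy]
  exact topForm_comp_linearMap e
    (extDeriv (inChart η x₁) (transition E x₀ x₁ y)).toAlternatingMap _

end Charts

/-! ### Stokes' theorem -/

section Stokes

open Set MeasureTheory

section VectorSpace

variable {E : Type*} [NormedAddCommGroup E] [NormedSpace ℝ E] [FiniteDimensional ℝ E]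
  [MeasurableSpace E] [BorelSpace E] (μ : Measure E) [μ.IsAddHaarMeasure]

theorem integral_fderiv_apply_eq_zero {g : E → ℂ} (hg : ContDiff ℝ 1 g) (hc : HasCompactSupport g)
    (v : E) : ∫ y, fderiv ℝ g y v ∂μ = 0 := by
  have hcont : Continuous fun y => fderiv ℝ g y v :=
    (hg.continuous_fderiv one_ne_zero).clm_apply continuous_const
  have hsupp : HasCompactSupport fun y => fderiv ℝ g y v := hc.fderiv_apply ℝ v
  have h := integral_smul_fderiv_eq_neg_fderiv_smul_of_integrable (μ := μ) (𝕜 := ℝ)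
    (f := fun _ : E => (1 : ℝ)) (g := g) (v := v) (by simp)
    (by simpa using hcont.integrable_of_hasCompactSupport hsupp)
    (by simpa using hg.continuous.integrable_of_hasCompactSupport hc)
    (fun _ _ => differentiableAt_const _) (fun x _ => hg.differentiable one_ne_zero x)
  simpa using h

theorem integral_extDeriv_eq_zero {r : ℕ} {h : E → E [⋀^Fin r]→L[ℝ] ℂ} (hh : ContDiff ℝ 1 h)
    (hc : HasCompactSupport h) (v : Fin (r + 1) → E) : ∫ y, extDeriv h y v ∂μ = 0 := by
  have hd : ∀ w : Fin r → E, ContDiff ℝ 1 fun y => h y w := fun w =>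
    (ContinuousAlternatingMap.apply ℝ E ℂ w).contDiff.comp hh
  have hs : ∀ w : Fin r → E, HasCompactSupport fun y => h y w := fun w =>
    hc.comp_left (g := fun α : E [⋀^Fin r]→L[ℝ] ℂ => α w) rfl
  have h1 : ∀ y, extDeriv h y v =
      ∑ i : Fin (r + 1), (-1) ^ (i : ℕ) • fderiv ℝ (fun z => h z (i.removeNth v)) y (v i) :=
    fun y => extDeriv_apply (hh.differentiable one_ne_zero y) v
  simp only [h1]
  rw [integral_finsetSum]
  · refine Finset.sum_eq_zero fun i _ => ?_
    have h2 := integral_fderiv_apply_eq_zero μ (hd (i.removeNth v)) (hs _) (v i)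
    rcases neg_one_pow_eq_or ℤ (i : ℕ) with hi | hi
    · simpa [hi] using h2
    · simpa [hi, integral_neg] using h2
  · intro i _
    refine Integrable.smul _ (Continuous.integrable_of_hasCompactSupport ?_ ?_)
    · exact ((hd _).continuous_fderiv one_ne_zero).clm_apply continuous_const
    · exact (hs _).fderiv_apply ℝ _

end VectorSpace

theorem integrableOn_of_eq_zero_off_compact {E : Type*} [NormedAddCommGroup E] [MeasurableSpace E]
    [BorelSpace E] {ν : Measure E} [IsFiniteMeasureOnCompacts ν]
    {g : E → ℂ} {T K : Set E} (hT : MeasurableSet T) (hg : ContinuousOn g T) (hK : IsCompact K)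
    (hKT : K ⊆ T) (h0 : ∀ y ∈ T, y ∉ K → g y = 0) : IntegrableOn g T ν :=
  ((hg.mono hKT).integrableOn_compact hK).of_forall_sdiff_eq_zero hT fun y hy => h0 y hy.1 hy.2

section Charts

variable {E : Type*} [NormedAddCommGroup E] [NormedSpace ℂ E]
  {M : Type*} [TopologicalSpace M] [ChartedSpace E M]

theorem inChart_eq_zero {r : ℕ} {η : DiffForm E M r} {x : M} {y : E}
    (h : η ((extChartAt 𝓘(ℂ, E) x).symm y) = 0) : inChart η x y = 0 := by
  rw [inChart, h]
  rfl

theorem extDeriv_inChart_eq_zero {r : ℕ} {η : DiffForm E M r} {K : Set M} (hK : IsClosed K)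
    (hη : ∀ z ∉ K, η z = 0) {x : M} {y : E} (hy : y ∈ (extChartAt 𝓘(ℂ, E) x).target)
    (hyK : (extChartAt 𝓘(ℂ, E) x).symm y ∉ K) : extDeriv (inChart η x) y = 0 := by
  have h : inChart η x =ᶠ[nhds y] fun _ => 0 := by
    have ho := (continuousOn_extChartAt_symm (I := 𝓘(ℂ, E)) x).isOpen_inter_preimage
      (isOpen_extChartAt_target x) hK.isOpen_compl
    filter_upwards [ho.mem_nhds ⟨hy, hyK⟩] with z hz
    exact inChart_eq_zero (hη _ hz.2)
  rw [h.extDeriv_eq, extDeriv]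
  ext v
  simp [ContinuousAlternatingMap.alternatizeUncurryFin_apply]

theorem continuousOn_extDeriv_inChart {r : ℕ} {η : DiffForm E M r} (hη : IsSmooth η) (x : M)
    (v : Fin (r + 1) → E) : ContinuousOn (fun y => extDeriv (inChart η x) y v)
      (extChartAt 𝓘(ℂ, E) x).target := by
  intro y hy
  have h1 : ContinuousAt (fderiv ℝ (inChart η x)) y :=
    ((hη.contDiffAt hy).fderiv_right (m := 0) (by simp)).continuousAt
  have h2 : ∀ᶠ z in nhds y, extDeriv (inChart η x) z v =
      ∑ i : Fin (r + 1), (-1) ^ (i : ℕ) • fderiv ℝ (inChart η x) z (v i) (i.removeNth v) := by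
    refine Filter.Eventually.of_forall fun z => ?_
    rw [extDeriv, ContinuousAlternatingMap.alternatizeUncurryFin_apply]
  refine ContinuousAt.continuousWithinAt (ContinuousAt.congr ?_ (h2.mono fun _ h => h.symm))
  refine tendsto_finsetSum _ fun i _ => ContinuousAt.const_smul ?_ _
  exact (ContinuousAlternatingMap.apply ℝ E ℂ (i.removeNth v)).continuous.continuousAt.comp
    (h1.clm_apply continuousAt_const)

/-- The image in a chart of a compact subset of its source. -/
theorem isCompact_image_extChartAt {K : Set M} (hK : IsCompact K) {x : M}
    (hKx : K ⊆ (extChartAt 𝓘(ℂ, E) x).source) :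
    IsCompact (extChartAt 𝓘(ℂ, E) x '' K) ∧
      extChartAt 𝓘(ℂ, E) x '' K ⊆ (extChartAt 𝓘(ℂ, E) x).target ∧
      ∀ y ∈ (extChartAt 𝓘(ℂ, E) x).target, y ∉ extChartAt 𝓘(ℂ, E) x '' K →
        (extChartAt 𝓘(ℂ, E) x).symm y ∉ K := by
  refine ⟨hK.image_of_continuousOn ((continuousOn_extChartAt x).mono hKx), ?_, ?_⟩
  · rintro _ ⟨z, hz, rfl⟩
    exact (extChartAt 𝓘(ℂ, E) x).map_source (hKx hz)
  · intro y hy hyK h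
    exact hyK ⟨_, h, (extChartAt 𝓘(ℂ, E) x).right_inv hy⟩

end Charts

variable {E : Type*} [NormedAddCommGroup E] [NormedSpace ℂ E] [FiniteDimensional ℂ E]
  [MeasurableSpace E] [BorelSpace E] (μ : Measure E) [μ.IsAddHaarMeasure]
  {M : Type*} [TopologicalSpace M] [ChartedSpace E M]

/-- Stokes' theorem for a form with compact support in the domain of a chart. -/
theorem setIntegral_extDeriv_inChart_eq_zero {r : ℕ} {η : DiffForm E M r} (hη : IsSmooth η)
    {K : Set M} (hK : IsCompact K) {x : M} (hKx : K ⊆ (extChartAt 𝓘(ℂ, E) x).source)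
    (h0 : ∀ z ∉ K, η z = 0) (v : Fin (r + 1) → E) :
    ∫ y in (extChartAt 𝓘(ℂ, E) x).target, extDeriv (inChart η x) y v ∂μ = 0 := by
  obtain ⟨hc, hsub, hoff⟩ := isCompact_image_extChartAt hK hKx
  set T := (extChartAt 𝓘(ℂ, E) x).target with hT
  have hTo : IsOpen T := isOpen_extChartAt_target x
  set h : E → E [⋀^Fin r]→L[ℝ] ℂ := T.indicator (inChart η x) with hh
  have hz : ∀ y ∉ extChartAt 𝓘(ℂ, E) x '' K, h y = 0 := by
    intro y hy
    by_cases hyT : y ∈ T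
    · rw [hh, indicator_of_mem hyT]
      exact inChart_eq_zero (h0 _ (hoff y hyT hy))
    · rw [hh, indicator_of_notMem hyT]
  have hev : ∀ y ∈ T, h =ᶠ[nhds y] inChart η x := fun y hy => by
    filter_upwards [hTo.mem_nhds hy] with z hz
    rw [hh, indicator_of_mem hz]
  have hev' : ∀ y ∉ extChartAt 𝓘(ℂ, E) x '' K, h =ᶠ[nhds y] fun _ => 0 := fun y hy => by
    filter_upwards [hc.isClosed.isOpen_compl.mem_nhds hy] with z hz'
    exact hz z hz'
  have hsm : ContDiff ℝ 1 h := by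
    rw [contDiff_iff_contDiffAt]
    intro y
    by_cases hy : y ∈ extChartAt 𝓘(ℂ, E) x '' K
    · exact (((hη.contDiffAt (hsub hy)).of_le (by simp)).congr_of_eventuallyEq (hev y (hsub hy)))
    · exact contDiffAt_const.congr_of_eventuallyEq (hev' y hy)
  have hcs : HasCompactSupport h := HasCompactSupport.intro hc hz
  rw [← integral_extDeriv_eq_zero μ hsm hcs v]
  rw [setIntegral_congr_fun (g := fun y => extDeriv h y v) hTo.measurableSet]
  · refine setIntegral_eq_integral_of_forall_compl_eq_zero fun y hy => ?_
    rw [(hev' y fun h => hy (hsub h)).extDeriv_eq, extDeriv]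
    simp [ContinuousAlternatingMap.alternatizeUncurryFin_apply]
  · intro y hy
    simp only [(hev y hy).extDeriv_eq]

variable [IsManifold 𝓘(ℂ, E) ω M]

/-- The integral of the exterior derivative of a form `η` of degree `2n-1`, weighted by a function
`f`, may be computed in any chart: here `η` is supported in the domain of one chart and `f` in
that of the other. -/
theorem setIntegral_extDeriv_inChart_change {r : ℕ} {η : DiffForm E M r} (hη : IsSmooth η)
    (e : Module.Basis (Fin (r + 1)) ℝ E) {K : Set M} (hK : IsClosed K) {x₀ x₁ : M}
    (hKx : K ⊆ (extChartAt 𝓘(ℂ, E) x₀).source) (h0 : ∀ z ∉ K, η z = 0) (f : M → ℝ)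
    (hf : ∀ z ∉ (extChartAt 𝓘(ℂ, E) x₁).source, f z = 0) :
    ∫ y in (extChartAt 𝓘(ℂ, E) x₁).target,
        f ((extChartAt 𝓘(ℂ, E) x₁).symm y) • extDeriv (inChart η x₁) y e ∂μ =
      ∫ y in (extChartAt 𝓘(ℂ, E) x₀).target,
        f ((extChartAt 𝓘(ℂ, E) x₀).symm y) • extDeriv (inChart η x₀) y e ∂μ := by
  have h1 : ∫ y in (extChartAt 𝓘(ℂ, E) x₁).target,
        f ((extChartAt 𝓘(ℂ, E) x₁).symm y) • extDeriv (inChart η x₁) y e ∂μ =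
      ∫ y in overlap E x₁ x₀,
        f ((extChartAt 𝓘(ℂ, E) x₁).symm y) • extDeriv (inChart η x₁) y e ∂μ := by
    refine setIntegral_eq_of_subset_of_forall_sdiff_eq_zero
      (isOpen_extChartAt_target x₁).measurableSet inter_subset_left fun y hy => ?_
    rw [extDeriv_inChart_eq_zero hK h0 hy.1 fun h => hy.2 ⟨hy.1, hKx h⟩]
    simp
  have h2 : ∫ y in (extChartAt 𝓘(ℂ, E) x₀).target,
        f ((extChartAt 𝓘(ℂ, E) x₀).symm y) • extDeriv (inChart η x₀) y e ∂μ =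
      ∫ y in overlap E x₀ x₁,
        f ((extChartAt 𝓘(ℂ, E) x₀).symm y) • extDeriv (inChart η x₀) y e ∂μ := by
    refine setIntegral_eq_of_subset_of_forall_sdiff_eq_zero
      (isOpen_extChartAt_target x₀).measurableSet inter_subset_left fun y hy => ?_
    rw [hf _ fun h => hy.2 ⟨hy.1, h⟩, zero_smul]
  have himg : transition E x₁ x₀ '' overlap E x₁ x₀ = overlap E x₀ x₁ := by
    refine Subset.antisymm ?_ fun y hy => ⟨_, transition_mem_overlap hy, transition_transition hy⟩
    rintro _ ⟨y, hy, rfl⟩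
    exact transition_mem_overlap hy
  have hinj : InjOn (transition E x₁ x₀) (overlap E x₁ x₀) := fun y hy z hz h => by
    rw [← transition_transition hy, h, transition_transition hz]
  rw [h1, h2, ← himg, integral_image_eq_integral_abs_det_fderiv_smul μ
    (isOpen_overlap x₁ x₀).measurableSet (f' := fun y => fderiv ℝ (transition E x₁ x₀) y)
    (fun y hy => ?_) hinj]
  · refine setIntegral_congr_fun (isOpen_overlap x₁ x₀).measurableSet fun y hy => ?_
    rw [symm_transition hy, abs_of_nonneg (det_fderiv_transition_nonneg hy),
      extDeriv_inChart_apply_eq hη e hy]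
    simp only [Complex.real_smul]
    ring
  · exact (((contDiffAt_transition hy).restrict_scalars ℝ).differentiableAt
      (by simp)).hasFDerivAt.hasFDerivWithinAt

end Stokes

section GlobalStokes

open Set MeasureTheory

variable {E : Type*} [NormedAddCommGroup E] [NormedSpace ℂ E]
  {M : Type*} [TopologicalSpace M] [ChartedSpace E M]

theorem IsSmooth.smul {r : ℕ} {η : DiffForm E M r} (hη : IsSmooth η) {f : M → ℝ}
    (hf : ∀ x : M, ContDiffOn ℝ ∞ (f ∘ (extChartAt 𝓘(ℂ, E) x).symm)
      (extChartAt 𝓘(ℂ, E) x).target) : IsSmooth fun x => f x • η x :=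
  fun x => ((hf x).smul (hη x)).congr fun _ _ => by
    ext v
    rfl

/-- A finite smooth partition of unity subordinate to charts. -/
theorem exists_partitionOfUnity (E : Type*) [NormedAddCommGroup E] [NormedSpace ℂ E]
    [FiniteDimensional ℂ E] (M : Type*) [TopologicalSpace M] [T2Space M] [CompactSpace M]
    [ChartedSpace E M] [IsManifold 𝓘(ℂ, E) ω M] :
    ∃ (t : Finset M) (ρ : t → M → ℝ) (K : t → Set M), (∀ i, IsCompact (K i)) ∧
      (∀ i, K i ⊆ (extChartAt 𝓘(ℂ, E) (i : M)).source) ∧ (∀ i, ∀ z ∉ K i, ρ i z = 0) ∧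
      (∀ i z, 0 ≤ ρ i z) ∧ (∀ z, ∑ i, ρ i z = 1) ∧
      ∀ i x, ContDiffOn ℝ ∞ (ρ i ∘ (extChartAt 𝓘(ℂ, E) x).symm)
        (extChartAt 𝓘(ℂ, E) x).target := by
  have := isManifold_real E M
  obtain ⟨t, ht⟩ := CompactSpace.elim_nhds_subcover
    (fun x : M => (extChartAt 𝓘(ℂ, E) x).source) fun x => extChartAt_source_mem_nhds x
  obtain ⟨f, hf⟩ := SmoothPartitionOfUnity.exists_isSubordinate 𝓘(ℝ, E) (isClosed_univ (X := M))
    (fun i : t => (extChartAt 𝓘(ℂ, E) (i : M)).source) (fun i => isOpen_extChartAt_source _)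
    (by
      intro x _
      have hx : x ∈ ⋃ i ∈ t, (extChartAt 𝓘(ℂ, E) i).source := by rw [ht]; trivial
      simp only [mem_iUnion] at hx ⊢
      obtain ⟨i, hi, hx⟩ := hx
      exact ⟨⟨i, hi⟩, hx⟩)
  refine ⟨t, fun i => f i, fun i => tsupport (f i), fun i => (isClosed_tsupport _).isCompact,
    hf, fun i z hz => image_eq_zero_of_notMem_tsupport hz, fun i z => f.nonneg i z, fun z => ?_,
    fun i x => ?_⟩
  · rw [← finsum_eq_sum_of_fintype]
    exact f.sum_eq_one (mem_univ z)
  · rw [← contMDiffOn_iff_contDiffOn]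
    exact (f i).contMDiff.comp_contMDiffOn (contMDiffOn_extChartAt_symm (I := 𝓘(ℝ, E)) x)

/-- Stokes' theorem on a compact complex manifold, in terms of a partition of unity: the sum on
the left is the integral of `dη` over `M`. -/
theorem sum_setIntegral_extDeriv_inChart_eq_zero [FiniteDimensional ℂ E] [T2Space M]
    [CompactSpace M] [IsManifold 𝓘(ℂ, E) ω M] [MeasurableSpace E] [BorelSpace E]
    (μ : Measure E) [μ.IsAddHaarMeasure] {r : ℕ} {η : DiffForm E M r} (hη : IsSmooth η)
    (e : Module.Basis (Fin (r + 1)) ℝ E) {t : Finset M} {ρ : t → M → ℝ} {K : t → Set M}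
    (hK : ∀ i, IsCompact (K i)) (hKs : ∀ i, K i ⊆ (extChartAt 𝓘(ℂ, E) (i : M)).source)
    (h0 : ∀ i, ∀ z ∉ K i, ρ i z = 0) (h1 : ∀ z, ∑ i, ρ i z = 1)
    (hρ : ∀ i x, ContDiffOn ℝ ∞ (ρ i ∘ (extChartAt 𝓘(ℂ, E) x).symm)
      (extChartAt 𝓘(ℂ, E) x).target) :
    ∑ j : t, ∫ y in (extChartAt 𝓘(ℂ, E) (j : M)).target,
      ρ j ((extChartAt 𝓘(ℂ, E) (j : M)).symm y) • extDeriv (inChart η j) y e ∂μ = 0 := by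
  set ηi : t → DiffForm E M r := fun i x => ρ i x • η x with hηi
  have hs : ∀ i, IsSmooth (ηi i) := fun i => hη.smul (hρ i)
  have hz : ∀ i, ∀ z ∉ K i, ηi i z = 0 := fun i z hz => by
    ext v
    change ρ i z • η z v = 0
    rw [h0 i z hz, zero_smul]
  have hcont : ∀ j i : t, ∀ x : M, ContinuousOn (fun y =>
      ρ j ((extChartAt 𝓘(ℂ, E) x).symm y) • extDeriv (inChart (ηi i) x) y e)
        (extChartAt 𝓘(ℂ, E) x).target := fun j i x =>
    (hρ j x).continuousOn.smul (continuousOn_extDeriv_inChart (hs i) x e)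
  -- decompose `η` inside each chart
  have hdec : ∀ j : t, ∀ y ∈ (extChartAt 𝓘(ℂ, E) (j : M)).target, extDeriv (inChart η j) y =
      ∑ i, extDeriv (inChart (ηi i) j) y := by
    intro j y hy
    have h2 : inChart η (j : M) = fun z => ∑ i, inChart (ηi i) (j : M) z := by
      funext z
      have : ∀ i, inChart (ηi i) (j : M) z =
        ρ i ((extChartAt 𝓘(ℂ, E) (j : M)).symm z) • inChart η (j : M) z := fun i => rfl
      simp only [this]
      rw [← Finset.sum_smul, h1, one_smul]
    rw [extDeriv, h2, fderiv_fun_sum fun i _ =>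
      ((hs i).contDiffAt hy).differentiableAt (by simp)]
    ext v
    simp only [ContinuousAlternatingMap.alternatizeUncurryFin_apply, extDeriv,
      ContinuousAlternatingMap.sum_apply, sum_apply, Finset.smul_sum]
    exact Finset.sum_comm
  have hint1 : ∀ j i : t, IntegrableOn (fun y => ρ j ((extChartAt 𝓘(ℂ, E) (j : M)).symm y) •
      extDeriv (inChart (ηi i) j) y e) (extChartAt 𝓘(ℂ, E) (j : M)).target μ := by
    intro j i
    obtain ⟨hc, hsub, hoff⟩ := isCompact_image_extChartAt (hK j) (hKs j)
    refine integrableOn_of_eq_zero_off_compact (isOpen_extChartAt_target _).measurableSet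
      (hcont j i j) hc hsub fun y hy hyK => ?_
    rw [h0 j _ (hoff y hy hyK), zero_smul]
  have hint2 : ∀ j i : t, IntegrableOn (fun y => ρ j ((extChartAt 𝓘(ℂ, E) (i : M)).symm y) •
      extDeriv (inChart (ηi i) i) y e) (extChartAt 𝓘(ℂ, E) (i : M)).target μ := by
    intro j i
    obtain ⟨hc, hsub, hoff⟩ := isCompact_image_extChartAt (hK i) (hKs i)
    refine integrableOn_of_eq_zero_off_compact (isOpen_extChartAt_target _).measurableSet
      (hcont j i i) hc hsub fun y hy hyK => ?_
    rw [extDeriv_inChart_eq_zero (hK i).isClosed (hz i) hy (hoff y hy hyK)]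
    simp
  calc _ = ∑ j : t, ∑ i : t, ∫ y in (extChartAt 𝓘(ℂ, E) (j : M)).target,
        ρ j ((extChartAt 𝓘(ℂ, E) (j : M)).symm y) • extDeriv (inChart (ηi i) j) y e ∂μ := by
        refine Finset.sum_congr rfl fun j _ => ?_
        rw [← integral_finsetSum _ fun i _ => hint1 j i]
        refine setIntegral_congr_fun (isOpen_extChartAt_target _).measurableSet fun y hy => ?_
        simp only [hdec j y hy, ContinuousAlternatingMap.sum_apply, Finset.smul_sum]
    _ = ∑ j : t, ∑ i : t, ∫ y in (extChartAt 𝓘(ℂ, E) (i : M)).target,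
        ρ j ((extChartAt 𝓘(ℂ, E) (i : M)).symm y) • extDeriv (inChart (ηi i) i) y e ∂μ :=
      Finset.sum_congr rfl fun j _ => Finset.sum_congr rfl fun i _ =>
        setIntegral_extDeriv_inChart_change μ (hs i) e (hK i).isClosed (hKs i) (hz i) (ρ j)
          fun z hz' => h0 j z fun h => hz' (hKs j h)
    _ = ∑ i : t, ∫ y in (extChartAt 𝓘(ℂ, E) (i : M)).target,
        extDeriv (inChart (ηi i) i) y e ∂μ := by
      rw [Finset.sum_comm]
      refine Finset.sum_congr rfl fun i _ => ?_
      rw [← integral_finsetSum _ fun j _ => hint2 j i]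
      refine setIntegral_congr_fun (isOpen_extChartAt_target _).measurableSet fun y hy => ?_
      rw [← Finset.sum_smul, h1, one_smul]
    _ = 0 := Finset.sum_eq_zero fun i _ =>
      setIntegral_extDeriv_inChart_eq_zero μ (hs i) (hK i) (hKs i) (hz i) e

/-- On a compact complex manifold, if `dη` is a nonnegative form of top degree then `dη = 0`. The
form `dη` is considered at the centre of the chart at each point, and its sign refers to a constant
`C ≠ 0`. -/
theorem extDeriv_inChart_eq_zero_of_nonneg [FiniteDimensional ℂ E] [T2Space M]
    [CompactSpace M] [IsManifold 𝓘(ℂ, E) ω M] {r : ℕ} {η : DiffForm E M r} (hη : IsSmooth η)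
    (e : Module.Basis (Fin (r + 1)) ℝ E) {C : ℂ} (hC : C ≠ 0)
    (hpos : ∀ x : M, ∃ a : ℝ, 0 ≤ a ∧
      extDeriv (inChart η x) (extChartAt 𝓘(ℂ, E) x x) e = a * C) (x : M) :
    extDeriv (inChart η x) (extChartAt 𝓘(ℂ, E) x x) e = 0 := by
  borelize E
  let μ : Measure E := Measure.addHaar
  obtain ⟨t, ρ, K, hK, hKs, h0, hnn, h1, hρ⟩ := exists_partitionOfUnity E M
  have hsum := sum_setIntegral_extDeriv_inChart_eq_zero μ hη e hK hKs h0 h1 hρ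
  -- the coefficient of `ρ j • dη` in the chart `j`, divided by `C`
  set g : t → E → ℂ := fun j y =>
    (ρ j ((extChartAt 𝓘(ℂ, E) (j : M)).symm y) • extDeriv (inChart η j) y e) / C with hg
  have hgpos : ∀ (j : t), ∀ y ∈ (extChartAt 𝓘(ℂ, E) (j : M)).target,
      ∃ a : ℝ, 0 ≤ a ∧ g j y = a := by
    intro j y hy
    set x := (extChartAt 𝓘(ℂ, E) (j : M)).symm y with hx
    have hov : y ∈ overlap E (j : M) x := ⟨hy, mem_extChartAt_source x⟩
    obtain ⟨a, ha, hax⟩ := hpos x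
    have h2 := extDeriv_inChart_apply_eq hη e hov
    have h3 : transition E (j : M) x y = extChartAt 𝓘(ℂ, E) x x := rfl
    rw [h3, hax] at h2
    refine ⟨ρ j x * ((fderiv ℝ (transition E (j : M) x) y).det * a),
      mul_nonneg (hnn j x) (mul_nonneg (det_fderiv_transition_nonneg hov) ha), ?_⟩
    simp only [hg, h2, ← hx, Complex.real_smul]
    push_cast
    field_simp
  have hgc : ∀ j : t, ContinuousOn (g j) (extChartAt 𝓘(ℂ, E) (j : M)).target := fun j =>
    ((hρ j j).continuousOn.smul (continuousOn_extDeriv_inChart hη (j : M) e)).div_const C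
  have hgi : ∀ j : t, IntegrableOn (g j) (extChartAt 𝓘(ℂ, E) (j : M)).target μ := by
    intro j
    obtain ⟨hc, hsub, hoff⟩ := isCompact_image_extChartAt (hK j) (hKs j)
    refine integrableOn_of_eq_zero_off_compact (isOpen_extChartAt_target _).measurableSet
      (hgc j) hc hsub fun y hy hyK => ?_
    simp only [hg]
    rw [h0 j _ (hoff y hy hyK), zero_smul, zero_div]
  have hre : ∀ j : t, ∫ y in (extChartAt 𝓘(ℂ, E) (j : M)).target, (g j y).re ∂μ =
      (∫ y in (extChartAt 𝓘(ℂ, E) (j : M)).target, g j y ∂μ).re := fun j =>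
    integral_re (hgi j)
  have hsum' : ∑ j : t, ∫ y in (extChartAt 𝓘(ℂ, E) (j : M)).target, (g j y).re ∂μ = 0 := by
    simp only [hre]
    rw [← Complex.re_sum]
    simp only [hg, integral_div]
    rw [← Finset.sum_div, hsum]
    simp
  have hnn' : ∀ j : t, ∀ y ∈ (extChartAt 𝓘(ℂ, E) (j : M)).target, 0 ≤ (g j y).re := by
    intro j y hy
    obtain ⟨a, ha, h⟩ := hgpos j y hy
    simpa [h] using ha
  have hj : ∀ j : t, ∫ y in (extChartAt 𝓘(ℂ, E) (j : M)).target, (g j y).re ∂μ = 0 := fun j =>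
    (Finset.sum_eq_zero_iff_of_nonneg fun i _ => setIntegral_nonneg
      (isOpen_extChartAt_target _).measurableSet (hnn' i)).mp hsum' j (Finset.mem_univ j)
  have hgz : ∀ j : t, ∀ y ∈ (extChartAt 𝓘(ℂ, E) (j : M)).target, g j y = 0 := by
    intro j y hy
    have h2 := (setIntegral_eq_zero_iff_of_nonneg_ae
      (ae_restrict_of_forall_mem (isOpen_extChartAt_target _).measurableSet (hnn' j))
      (hgi j).re).mp (hj j)
    have h3 : (g j y).re = 0 := Measure.eqOn_open_of_ae_eq h2 (isOpen_extChartAt_target _)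
      (Complex.continuous_re.comp_continuousOn (hgc j)) continuousOn_const hy
    obtain ⟨a, ha, h⟩ := hgpos j y hy
    rw [h] at h3 ⊢
    simpa using h3
  -- some `ρ j` does not vanish at `x`
  obtain ⟨j, hjx⟩ : ∃ j, ρ j x ≠ 0 := by
    by_contra! h
    have := h1 x
    simp [h] at this
  have hxj : x ∈ (extChartAt 𝓘(ℂ, E) (j : M)).source := by
    by_contra h
    exact hjx (h0 j x fun h' => h (hKs j h'))
  have hov : extChartAt 𝓘(ℂ, E) x x ∈ overlap E x (j : M) := by
    refine ⟨mem_extChartAt_target x, ?_⟩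
    rwa [mem_preimage, extChartAt_to_inv]
  have h4 := hgz j _ (transition_mem_overlap hov).1
  simp only [hg] at h4
  rw [symm_transition hov, extChartAt_to_inv, div_eq_zero_iff, smul_eq_zero] at h4
  rw [extDeriv_inChart_apply_eq hη e hov, (h4.resolve_right hC).resolve_left hjx, mul_zero]

end GlobalStokes

/-! ### Transverse forms that are exact in Aeppli cohomology -/

section Transverse

variable {E : Type*} [NormedAddCommGroup E] [NormedSpace ℂ E] [FiniteDimensional ℂ E]

theorem exists_basis_dual (E : Type*) [NormedAddCommGroup E] [NormedSpace ℂ E]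
    [FiniteDimensional ℂ E] :
    Nonempty (Module.Basis (Fin (Module.finrank ℂ E)) ℂ (E →L[ℂ] ℂ)) := by
  refine ⟨Module.finBasisOfFinrankEq ℂ (E →L[ℂ] ℂ) ?_⟩
  rw [← (LinearMap.toContinuousLinearMap : (E →ₗ[ℂ] ℂ) ≃ₗ[ℂ] (E →L[ℂ] ℂ)).finrank_eq]
  exact Subspace.dual_finrank_eq

theorem castDegree_volForm_apply_ne_zero {n N : ℕ} (φ : Module.Basis (Fin n) ℂ (E →L[ℂ] ℂ))
    (hN : n + n = N) (e : Module.Basis (Fin N) ℝ E) : castDegree hN (volForm φ) e ≠ 0 := by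
  subst hN
  intro h
  refine volForm_ne_zero φ ?_
  ext v
  have h1 := topForm_apply e (volForm φ).toAlternatingMap v
  change volForm φ v = _ * volForm φ e at h1
  rw [h1, show volForm φ e = 0 from h]
  simp

omit [FiniteDimensional ℂ E] in
/-- Strict positivity of `σ_k Ω ∧ ξ ∧ conj ξ`, read off from its value on an arbitrary family `e` of
`2n` vectors. The constant on the right only depends on `φ` and `e`. -/
theorem IsTransverse.exists_pos {p k N : ℕ} (hk : k = Module.finrank ℂ E - p)
    {Ω : E [⋀^Fin (p + p)]→L[ℝ] ℂ} (hΩ : IsTransverse p Ω)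
    {ξ : E [⋀^Fin k]→L[ℝ] ℂ} (hξ : IsSimple ξ) (hξ0 : ξ ≠ 0)
    (φ : Module.Basis (Fin (Module.finrank ℂ E)) ℂ (E →L[ℂ] ℂ))
    (hN : Module.finrank ℂ E + Module.finrank ℂ E = N) (hN' : p + p + k + k = N) (e : Fin N → E) :
    ∃ a : ℝ, 0 < a ∧ castDegree hN' (wedge (wedge Ω ξ) (conjForm ξ)) e =
      a * (castDegree hN (volForm φ) e / sigmaConst k) := by
  subst hk hN
  obtain ⟨h, h2⟩ := hΩ ξ hξ hξ0
  obtain ⟨a, ha, h3⟩ := h2 φ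
  refine ⟨a, ha, ?_⟩
  have h4 : sigmaConst (Module.finrank ℂ E - p) *
      castDegree hN' (wedge (wedge Ω ξ) (conjForm ξ)) e = a * volForm φ e :=
    congrArg (fun α => α e) h3
  rw [mul_div_assoc', eq_div_iff (sigmaConst_ne_zero _), mul_comm, h4]
  rfl

variable {M : Type*} [TopologicalSpace M] [ChartedSpace E M]

omit [FiniteDimensional ℂ E] in
theorem hasJWeight_inChart {p q r : ℕ} {η : DiffForm E M r}
    (hη : ∀ x, η x ∈ typeForms (TangentSpace 𝓘(ℂ, E) x) p q r) (x : M) (y : E) :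
    HasJWeight (Complex.I ^ p * (-Complex.I) ^ q) (inChart η x y) :=
  (hasJWeight_of_mem_typeForms (hη _)).compContinuousLinearMap _

omit [FiniteDimensional ℂ E] in
theorem inChart_wedge {r s : ℕ} (α : DiffForm E M r) (β : DiffForm E M s) (x : M) (y : E) :
    inChart (fun z => wedge (α z) (β z)) x y = wedge (inChart α x y) (inChart β x y) :=
  (wedge_compContinuousLinearMap _ _ _).symm

theorem IsSmooth.wedge {r s : ℕ} {α : DiffForm E M r} {β : DiffForm E M s} (hα : IsSmooth α)
    (hβ : IsSmooth β) : IsSmooth fun x => wedge (α x) (β x) := fun x => by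
  have h := (wedgeCLM E r s).isBoundedBilinearMap.contDiff.comp_contDiffOn ((hα x).prodMk (hβ x))
  exact h.congr fun y _ => inChart_wedge α β x y

theorem IsSmooth.conjForm {r : ℕ} {α : DiffForm E M r} (hα : IsSmooth α) :
    IsSmooth fun x => conjForm (α x) := fun x =>
  ((conjFormCLM E r).contDiff.comp_contDiffOn (hα x)).congr fun _ _ => rfl

omit [FiniteDimensional ℂ E] in
theorem IsSmooth.add {r : ℕ} {α β : DiffForm E M r} (hα : IsSmooth α) (hβ : IsSmooth β) :
    IsSmooth fun x => α x + β x := fun x =>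
  ((hα x).add (hβ x)).congr fun _ _ => rfl

/-- The form `(μ + ν) ∧ ξ ∧ conj ξ`. -/
def primitiveForm {s k : ℕ} (μ ν : DiffForm E M s) (ξ : DiffForm E M k) :
    DiffForm E M (s + k + k) := fun z => wedge (wedge (μ z + ν z) (ξ z)) (conjForm (ξ z))

theorem isSmooth_primitiveForm {s k : ℕ} {μ ν : DiffForm E M s} {ξ : DiffForm E M k}
    (hμ : IsSmooth μ) (hν : IsSmooth ν) (hξ : IsSmooth ξ) : IsSmooth (primitiveForm μ ν ξ) :=
  ((hμ.add hν).wedge hξ).wedge hξ.conjForm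

variable [IsManifold 𝓘(ℂ, E) ω M]

/-- If `ξ` is a closed `(k,0)`-form, `k = n - p`, then `(∂μ + ∂bar ν) ∧ ξ ∧ conj ξ` is the exterior
derivative of `(μ + ν) ∧ ξ ∧ conj ξ`. Here `p = q + 1`, and both sides are taken at the centre of the
chart at `x`. -/
theorem extDeriv_inChart_wedge_eq {q s k : ℕ} {μ ν : DiffForm E M s} {ξ : DiffForm E M k}
    (hμ : IsSmoothOfType q (q + 1) μ) (hν : IsSmoothOfType (q + 1) q ν)
    (hξ : IsSmoothOfType k 0 ξ) (hd : del ξ = 0) (hdbar : delbar ξ = 0)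
    (hE : Module.finrank ℝ E = s + 1 + k + k) (h : s + 1 + k + k = s + k + k + 1) (x : M) :
    extDeriv (inChart (primitiveForm μ ν ξ) x)
        (extChartAt 𝓘(ℂ, E) x x) =
      castDegree h (wedge (wedge (del μ x + delbar ν x) (ξ x)) (conjForm (ξ x))) := by
  have hx := mem_extChartAt_target (I := 𝓘(ℂ, E)) x
  have key := extDeriv_wedge_wedge_conjForm (q := q) (a := inChart μ x) (b := inChart ν x)
    (ξ := inChart ξ x) ((hμ.1.contDiffAt hx).differentiableAt (by simp))
    ((hν.1.contDiffAt hx).differentiableAt (by simp))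
    ((hξ.1.contDiffAt hx).differentiableAt (by simp))
    (Filter.Eventually.of_forall fun y => hasJWeight_inChart hμ.2 x y)
    (Filter.Eventually.of_forall fun y => hasJWeight_inChart hν.2 x y)
    (by simpa using hasJWeight_inChart hξ.2 x (extChartAt 𝓘(ℂ, E) x x))
    ((del_eq ξ x).symm.trans (congrFun hd x)) ((delbar_eq ξ x).symm.trans (congrFun hdbar x)) hE h
  have hθ : inChart (primitiveForm μ ν ξ) x =
      fun y => wedge (wedge (inChart μ x y + inChart ν x y) (inChart ξ x y))
        (conjForm (inChart ξ x y)) := by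
    funext y
    refine (inChart_wedge _ _ x y).trans ?_
    rw [inChart_wedge]
    rfl
  rw [hθ, key, del_eq, delbar_eq, ← inChart_self ξ x]
  rfl

end Transverse

end ComplexForms

end

open ComplexForms in
theorem mainTheorem7
    {E : Type*} [NormedAddCommGroup E] [NormedSpace ℂ E] [FiniteDimensional ℂ E]
    {M : Type*} [TopologicalSpace M] [T2Space M] [CompactSpace M]
    [ChartedSpace E M] [IsManifold 𝓘(ℂ, E) ω M]
    (n p k : ℕ) (hn : Module.finrank ℂ E = n) (hp : 1 ≤ p) (hpn : p ≤ n - 1) (hk : k = n - p)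
    (Ω : DiffForm E M (p + p)) (hΩ : IsPluriclosed p Ω) (hA : AeppliClassVanishes p Ω) :
    ¬ ∃ ξ : DiffForm E M k, IsSmoothOfType k 0 ξ ∧ (∀ x, IsSimple (ξ x)) ∧
      del ξ = 0 ∧ delbar ξ = 0 ∧ ξ ≠ 0 := by
  rintro ⟨ξ, hξ, hsimple, hd, hdbar, hne⟩
  obtain ⟨s, hs, μ, ν, hμ, hν, hΩA⟩ := hA
  obtain ⟨q, rfl⟩ : ∃ q, p = q + 1 := ⟨p - 1, by omega⟩
  rw [Nat.add_sub_cancel] at hμ hν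
  subst hn
  have hE : Module.finrank ℝ E = s + 1 + k + k := by
    rw [finrank_real_of_complex]
    omega
  have hN : Module.finrank ℂ E + Module.finrank ℂ E = s + k + k + 1 := by omega
  have hN' : q + 1 + (q + 1) + k + k = s + k + k + 1 := by omega
  have hN'' : s + 1 + k + k = s + k + k + 1 := by omega
  obtain ⟨φ⟩ := exists_basis_dual E
  let e : Module.Basis (Fin (s + k + k + 1)) ℝ E :=
    Module.finBasisOfFinrankEq ℝ E (hE.trans hN'')
  -- the value on `e` of a reference volume form, which the sign of a top degree form refers to
  have hC : castDegree hN (volForm φ) e / sigmaConst k ≠ 0 :=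
    div_ne_zero (castDegree_volForm_apply_ne_zero φ hN e) (sigmaConst_ne_zero k)
  have hθ : IsSmooth (primitiveForm μ ν ξ) := isSmooth_primitiveForm hμ.1 hν.1 hξ.1
  have hdθ : ∀ x, extDeriv (inChart (primitiveForm μ ν ξ) x)
      (extChartAt 𝓘(ℂ, E) x x) =
        castDegree hN' (wedge (wedge (Ω x) (ξ x)) (conjForm (ξ x))) := by
    intro x
    rw [extDeriv_inChart_wedge_eq hμ hν hξ hd hdbar hE hN'' x, hΩA x, wedge_castDegree_left,
      wedge_castDegree_left]
    rfl
  have hpos : ∀ x, ξ x ≠ 0 → ∃ a : ℝ, 0 < a ∧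
      extDeriv (inChart (primitiveForm μ ν ξ) x)
        (extChartAt 𝓘(ℂ, E) x x) e = a * (castDegree hN (volForm φ) e / sigmaConst k) := by
    intro x hx
    rw [hdθ x]
    exact IsTransverse.exists_pos (E := E) hk (hΩ.transverse x) (hsimple x) hx φ hN hN' e
  -- by Stokes, the nonnegative form `Ω ∧ ξ ∧ conj ξ` vanishes
  have hzero := extDeriv_inChart_eq_zero_of_nonneg hθ e hC fun x => by
    by_cases hx : ξ x = 0
    · refine ⟨0, le_rfl, ?_⟩
      rw [hdθ x, hx, wedge_zero_right, wedge_zero_left, castDegree_zero, Complex.ofReal_zero,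
        zero_mul]
      rfl
    · obtain ⟨a, ha, h⟩ := hpos x hx
      exact ⟨a, ha.le, h⟩
  refine hne (funext fun x => ?_)
  by_contra hx
  obtain ⟨a, ha, h⟩ := hpos x hx
  rw [hzero x] at h
  exact mul_ne_zero (Complex.ofReal_ne_zero.mpr ha.ne') hC h.symm
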